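/- **Theorem.** Let $1 < p, q < \infty$, let $q'$ be the conjugate exponent of $q$ ($\frac1q+\frac1{q'}=1$), let $L$ be a (full-rank) lattice in $\mathbb{R}^d$ with dual lattice $L^\perp = \{\kappa \in \mathbb{R}^d : \kappa\cdot\lambda \in \mathbb{Z} \text{ for all } \lambda \in L\}$, and let $\Omega$ be a fundamental domain of $L$, i.e. a measurable set containing exactly one representative of each coset of $L$ in $\mathbb{R}^d$. Let $C^\infty(\Omega)$ be the space of smooth $L$-periodic functions $f:\mathbb{R}^d\to\mathbb{C}$, let $\widehat f(\kappa) = \frac{1}{|\Omega|}\int_\Omega f(x) e^{-2\pi i \kappa\cdot x}\,dx$ for $\kappa \in L^\perp$, and let $L^r(\Omega)$ be taken with respect to the normalized measure $dx/|\Omega|$. Let $A : C^\infty(\Omega) \to C^\infty(\Omega)$ be a Fourier multiplier with symbol $\sigma : L^\perp \to \mathbb{C}$, i.e. $\widehat{Af}(\kappa) = \sigma(\kappa)\widehat f(\kappa)$ for all $f \in C^\infty(\Omega)$ and $\kappa\in L^\perp$, and put $$\|A\|_{L^p\to L^q} := \sup_{0\neq f \in C^\infty(\Omega)} \frac{\|Af\|_{L^q(\Omega)}}{\|f\|_{L^p(\Omega)}},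 \qquad M_e(\sigma) := \sup_{s>0} s\,\bigl(\#\{\kappa\in L^\perp : |\sigma(\kappa)|\ge s\}\bigr)^{e},$$ where levels $s$ with $\{|\sigma|\ge s\}=\emptyset$ contribute $0$ and $\infty^0=1$, so that $M_0(\sigma) = \sup_{\kappa} |\sigma(\kappa)|$. There is a constant $C_{p,q}$ depending only on $p$ and $q$ (not on $d$, $L$, $\Omega$, $A$, $\sigma$) such that: 1. If $1 < p, q \le 2$ and $M_{1/p-1/2}(\sigma) < \infty$, then $\|A\|_{L^p\to L^q} \le C_{p,q}\, M_{1/p-1/2}(\sigma)$. 2. If $2 \le p, q < \infty$ and $M_{1/q'-1/2}(\sigma) < \infty$, then $\|A\|_{L^p\to L^q} \le C_{p,q}\, M_{1/q'-1/2}(\sigma)$. In particular, in each case $A$ extends to a bounded linear operator from $L^p(\Omega)$ to $L^q(\Omega)$. -/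

import Mathlib

open MeasureTheory
open scoped ENNReal NNReal ContDiff

noncomputable section

namespace LatticeFourier

variable {d : ℕ}

/-- A fundamental domain of the lattice `L`: a (Lebesgue) measurable set containing exactly one
representative of every coset of `L`, i.e. `∑_{l ∈ L} 1_Ω (x + l) = 1` for all `x`. -/
structure IsFundamentalDomain (L : Submodule ℤ (EuclideanSpace ℝ (Fin d)))
    (Ω : Set (EuclideanSpace ℝ (Fin d))) : Prop where
  measurable : NullMeasurableSet Ω volume
  existsUnique : ∀ x : EuclideanSpace ℝ (Fin d), ∃! l : L, x + (l : EuclideanSpace ℝ (Fin d)) ∈ Ω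

/-- The dual lattice `{κ | ∀ l ∈ L, κ · l ∈ ℤ}`. -/
def dualLattice (L : Submodule ℤ (EuclideanSpace ℝ (Fin d))) : Set (EuclideanSpace ℝ (Fin d)) :=
  {κ | ∀ l ∈ L, ∃ n : ℤ, inner ℝ κ l = (n : ℝ)}

/-- Normalized Lebesgue measure `dx / |Ω|` on `Ω`; the spaces `L^p(Ω)` are taken with respect
to it. -/
def normVol (Ω : Set (EuclideanSpace ℝ (Fin d))) : Measure (EuclideanSpace ℝ (Fin d)) :=
  (volume Ω)⁻¹ • volume.restrict Ω

/-- `C^∞(Ω)`: the smooth `L`-periodic functions on `ℝ^d`. -/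
def smoothPeriodic (L : Submodule ℤ (EuclideanSpace ℝ (Fin d))) :
    Submodule ℂ (EuclideanSpace ℝ (Fin d) → ℂ) where
  carrier := {f | ContDiff ℝ ∞ f ∧ ∀ x, ∀ l ∈ L, f (x + l) = f x}
  add_mem' := fun {f g} hf hg =>
    ⟨hf.1.add hg.1, fun x l hl => by simp [hf.2 x l hl, hg.2 x l hl]⟩
  zero_mem' := ⟨contDiff_const, fun _ _ _ => rfl⟩
  smul_mem' := fun c f hf =>
    ⟨contDiff_const.smul hf.1, fun x l hl => by simp [hf.2 x l hl]⟩

/-- The Fourier coefficient `|Ω|⁻¹ ∫_Ω f(x) e^{-2πi κ·x} dx`. -/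
def fourierCoefficient (Ω : Set (EuclideanSpace ℝ (Fin d))) (f : EuclideanSpace ℝ (Fin d) → ℂ)
    (κ : EuclideanSpace ℝ (Fin d)) : ℂ :=
  ∫ x, f x * Complex.exp (-(2 * Real.pi * Complex.I * ((inner ℝ κ x : ℝ) : ℂ))) ∂(normVol Ω)

/-- `A : C^∞(Ω) → C^∞(Ω)` is a Fourier multiplier with symbol `σ`. -/
def IsFourierMultiplier {L : Submodule ℤ (EuclideanSpace ℝ (Fin d))}
    (Ω : Set (EuclideanSpace ℝ (Fin d))) (A : smoothPeriodic L → smoothPeriodic L)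
    (σ : dualLattice L → ℂ) : Prop :=
  ∀ (f : smoothPeriodic L) (κ : dualLattice L),
    fourierCoefficient Ω (A f : EuclideanSpace ℝ (Fin d) → ℂ) κ =
      σ κ * fourierCoefficient Ω (f : EuclideanSpace ℝ (Fin d) → ℂ) κ

/-- `‖A‖_{L^p → L^q} = sup_{f ≠ 0} ‖A f‖_q / ‖f‖_p`, the supremum over `f ∈ C^∞(Ω)`. -/
def opNorm {L : Submodule ℤ (EuclideanSpace ℝ (Fin d))}
    (Ω : Set (EuclideanSpace ℝ (Fin d))) (p q : ℝ)
    (A : smoothPeriodic L → smoothPeriodic L) : ℝ≥0∞ :=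
  ⨆ (f : smoothPeriodic L) (_ : f ≠ 0),
    eLpNorm (A f : EuclideanSpace ℝ (Fin d) → ℂ) (ENNReal.ofReal q) (normVol Ω) /
      eLpNorm (f : EuclideanSpace ℝ (Fin d) → ℂ) (ENNReal.ofReal p) (normVol Ω)

/-- `A` extends to a bounded linear operator from `L^p(Ω)` to `L^q(Ω)`. -/
def HasBoundedExtension {L : Submodule ℤ (EuclideanSpace ℝ (Fin d))}
    (Ω : Set (EuclideanSpace ℝ (Fin d))) (p q : ℝ)
    (A : smoothPeriodic L → smoothPeriodic L) : Prop :=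
  ∃ T : Lp ℂ (ENNReal.ofReal p) (normVol Ω) →ₗ[ℂ] Lp ℂ (ENNReal.ofReal q) (normVol Ω),
    (∃ K : ℝ, ∀ u, ‖T u‖ ≤ K * ‖u‖) ∧
    ∀ f : smoothPeriodic L, ∃ u : Lp ℂ (ENNReal.ofReal p) (normVol Ω),
      u =ᵐ[normVol Ω] (f : EuclideanSpace ℝ (Fin d) → ℂ) ∧
      T u =ᵐ[normVol Ω] (A f : EuclideanSpace ℝ (Fin d) → ℂ)

/-- `sup_{s > 0} s (#{κ : |σ(κ)| ≥ s})^e`. Levels `s` with empty superlevel set contribute `0`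
(also for `e = 0`, where the quantity is therefore the supremum of `|σ|`); for `e > 0` this
restriction changes nothing. -/
def weakNorm {L : Submodule ℤ (EuclideanSpace ℝ (Fin d))} (σ : dualLattice L → ℂ) (e : ℝ) :
    ℝ≥0∞ :=
  ⨆ (s : ℝ) (_ : 0 < s) (_ : {κ : dualLattice L | s ≤ ‖σ κ‖}.Nonempty),
    ENNReal.ofReal s * (({κ : dualLattice L | s ≤ ‖σ κ‖}.encard : ℕ∞) : ℝ≥0∞) ^ e

end LatticeFourier

end

/-! The engine is a Paley–Hörmander inequality (`exists_tsum_le`): for an orthonormal system of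
unimodular functions on a probability space and `1 < p ≤ 2`, the `ℓ²` norm of `σ i * coef f i` is at
most `C M ‖f‖_p`, where `M` is the weak quantity of `σ` with exponent `1/p - 1/2`. To prove it, cut
`σ` into dyadic levels `|σ| ∼ 2^k` and, on each level, cut `f` at a height `2^(-ak)`. The part of
`f` below the height is handled by Bessel. The part above has coefficients bounded by its `L¹` norm,
and the weak bound limits how many indices lie on the level. With `a = 2/(2-p)` both contributions
sum over `k` to multiples of `∫ |f|^p`. The constant depends on `p` alone.

If `q ≤ 2`, the `L^q` norm of the multiplier series is at most its `L²` norm, which is the `ℓ²` norm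
just bounded. If `p, q ≥ 2`, duality turns the inequality at exponent `q'` into a synthesis bound
from `ℓ²` to `L^q` (`exists_eLpNorm_sum_le`). This is applied to the coefficients of `f`, whose `ℓ²`
norm is at most `‖f‖_2 ≤ ‖f‖_p`.

In both cases the multiplier series defines a bounded linear `T` on all of `L^p`. It agrees with `A`
on smooth functions because the Fourier series of `A f` converges to `A f` in `L²`
(Stone–Weierstrass on the torus) and has the same terms. Linearity of `A` is thus a consequence, not
an assumption. -/

noncomputable section

namespace LatticeFourier

/-! ### Dyadic sums and the weak quantity of a symbol -/

/-- Dyadic powers below `z` sum to a multiple of the largest one. -/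
lemma exists_tsum_dyadic_le {b : ℝ} (hb : 0 < b) : ∃ c : ℝ≥0, ∀ z : ℝ, 0 < z →
    ∑' k : ℤ, (if (2 : ℝ) ^ k ≤ z then ENNReal.ofReal (((2 : ℝ) ^ k) ^ b) else 0) ≤
      c * ENNReal.ofReal (z ^ b) := by
  have hlt : (2 : ℝ) ^ (-b) < 1 := Real.rpow_lt_one_of_one_lt_of_neg (by norm_num) (by linarith)
  have hpos : 0 < (2 : ℝ) ^ (-b) := by positivity
  refine ⟨(1 - (2 : ℝ) ^ (-b))⁻¹.toNNReal, fun z hz => ?_⟩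
  -- `2 ^ m` is the largest power not exceeding `z`; the surviving indices are `m - j`, giving a
  -- geometric series of ratio `2 ^ (-b)`.
  obtain ⟨m, hm1, hm2⟩ := exists_mem_Ico_zpow hz (one_lt_two)
  have hinj : Function.Injective (fun j : ℕ => m - (j : ℤ)) := fun i j h => by
    simpa using h
  rw [← hinj.tsum_eq]
  · have hterm : ∀ j : ℕ, (if (2 : ℝ) ^ (m - (j : ℤ)) ≤ z then
        ENNReal.ofReal (((2 : ℝ) ^ (m - (j : ℤ))) ^ b) else 0) ≤
        ENNReal.ofReal (z ^ b) * ENNReal.ofReal ((2 : ℝ) ^ (-b)) ^ j := fun j => by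
      split_ifs
      · rw [← ENNReal.ofReal_pow hpos.le, ← ENNReal.ofReal_mul (by positivity)]
        apply ENNReal.ofReal_le_ofReal
        rw [zpow_sub₀ two_ne_zero, Real.div_rpow (by positivity) (by positivity), div_eq_mul_inv]
        have h2 : (((2 : ℝ) ^ (j : ℤ)) ^ b)⁻¹ = ((2 : ℝ) ^ (-b)) ^ j := by
          rw [zpow_natCast, ← Real.rpow_natCast, ← Real.rpow_natCast, ← Real.rpow_mul (by norm_num),
            ← Real.rpow_mul (by norm_num), ← Real.rpow_neg (by norm_num)]
          congr 1; ring
        rw [h2]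
        gcongr
      · positivity
    refine (ENNReal.tsum_le_tsum hterm).trans ?_
    rw [ENNReal.tsum_mul_left, ENNReal.tsum_geometric, mul_comm]
    gcongr
    rw [← ENNReal.ofReal_one, ← ENNReal.ofReal_sub _ hpos.le,
      ← ENNReal.ofReal_inv_of_pos (by linarith)]
    rfl
  · intro k hk
    have hk' : (2 : ℝ) ^ k ≤ z := by
      by_contra h
      simp [h] at hk
    have : k < m + 1 := (zpow_lt_zpow_iff_right₀ (one_lt_two (α := ℝ))).1 (hk'.trans_lt hm2)
    exact ⟨(m - k).toNat, by simp only; omega⟩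

lemma add_sq_le_two_mul (x y : ℝ≥0∞) : (x + y) ^ 2 ≤ 2 * x ^ 2 + 2 * y ^ 2 := by
  have := ENNReal.rpow_add_le_mul_rpow_add_rpow x y (p := 2) (by norm_num)
  norm_num at this
  rwa [mul_add] at this

/-- The supremum of `s * #{i : s ≤ ‖σ i‖} ^ a` over all `s > 0` with nonempty level set. -/
def weakSup {ι : Type*} (σ : ι → ℂ) (a : ℝ) : ℝ≥0∞ :=
  ⨆ (s : ℝ) (_ : 0 < s) (_ : {i | s ≤ ‖σ i‖}.Nonempty),
    ENNReal.ofReal s * (({i | s ≤ ‖σ i‖}.encard : ℕ∞) : ℝ≥0∞) ^ a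

section Weak
variable {ι : Type*} {σ : ι → ℂ} {a : ℝ}

lemma ofReal_mul_encard_rpow_le_weakSup {s : ℝ} (hs : 0 < s) (h : {i | s ≤ ‖σ i‖}.Nonempty) :
    ENNReal.ofReal s * (({i | s ≤ ‖σ i‖}.encard : ℕ∞) : ℝ≥0∞) ^ a ≤ weakSup σ a :=
  le_iSup_of_le s (le_iSup_of_le hs (le_iSup_of_le h le_rfl))

/-- Take `s = ‖σ i‖`: the level set contains `i`, so its count is at least one. Restricting to
nonempty level sets does no harm here. -/
lemma enorm_le_weakSup (ha : 0 ≤ a) (i : ι) : ‖σ i‖ₑ ≤ weakSup σ a := by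
  by_cases h : σ i = 0
  · simp [h]
  have hne : {j | ‖σ i‖ ≤ ‖σ j‖}.Nonempty := ⟨i, le_refl ‖σ i‖⟩
  refine le_trans ?_ (ofReal_mul_encard_rpow_le_weakSup (norm_pos_iff.2 h) hne)
  rw [ofReal_norm]
  have h1 : (1 : ℝ≥0∞) ≤ (({j | ‖σ i‖ ≤ ‖σ j‖}.encard : ℕ∞) : ℝ≥0∞) := by
    have := Set.one_le_encard_iff_nonempty.2 hne
    exact_mod_cast this
  calc ‖σ i‖ₑ = ‖σ i‖ₑ * 1 := (mul_one _).symm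
    _ ≤ _ := by gcongr; simpa using ENNReal.rpow_le_rpow h1 ha

lemma encard_le_of_weakSup_le {r : ℝ} (hr : 0 < r) {N : ℝ} (hN : 0 < N)
    (h : weakSup σ r⁻¹ ≤ ENNReal.ofReal N) {s : ℝ} (hs : 0 < s) :
    (({i | N * s ≤ ‖σ i‖}.encard : ℕ∞) : ℝ≥0∞) ≤ ENNReal.ofReal (s ^ (-r)) := by
  rcases Set.eq_empty_or_nonempty {i | N * s ≤ ‖σ i‖} with h0 | h0
  · simp [h0]
  have h1 := (ofReal_mul_encard_rpow_le_weakSup (a := r⁻¹) (by positivity) h0).trans h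
  set n : ℝ≥0∞ := (({i | N * s ≤ ‖σ i‖}.encard : ℕ∞) : ℝ≥0∞)
  have h2 : n ^ r⁻¹ ≤ ENNReal.ofReal s⁻¹ := by
    have hNs : 0 < N * s := by positivity
    rw [mul_comm, ← ENNReal.le_div_iff_mul_le (by simp [hNs]) (by simp),
      ← ENNReal.ofReal_div_of_pos hNs] at h1
    convert h1 using 2
    field_simp
  have h3 := ENNReal.rpow_le_rpow h2 hr.le
  rwa [← ENNReal.rpow_mul, inv_mul_cancel₀ hr.ne', ENNReal.rpow_one,
    ENNReal.ofReal_rpow_of_pos (by positivity), Real.inv_rpow hs.le, ← Real.rpow_neg hs.le] at h3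

end Weak

lemma eLpNorm_two_sq {X : Type*} [MeasurableSpace X] {μ : Measure X} (f : X → ℂ) :
    eLpNorm f 2 μ ^ 2 = ∫⁻ x, ‖f x‖ₑ ^ 2 ∂μ := by
  have := eLpNorm_nnreal_pow_eq_lintegral (f := f) (μ := μ) (p := 2) (by norm_num)
  simpa using this

/-! ### Coefficients along a unimodular orthonormal system, and Bessel's inequality -/

section Coef
variable {X : Type*} [MeasurableSpace X] {ι : Type*}

/-- The coefficient of `f` along `e i`. -/
def coef (μ : Measure X) (e : ι → X → ℂ) (f : X → ℂ) (i : ι) : ℂ :=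
  ∫ x, f x * starRingEnd ℂ (e i x) ∂μ

/-- An orthonormal family of functions of modulus one. -/
structure UnimodularSystem (μ : Measure X) (e : ι → X → ℂ) : Prop where
  meas : ∀ i, AEStronglyMeasurable (e i) μ
  norm_eq : ∀ i x, ‖e i x‖ = 1
  inner_self : ∀ i, ∫ x, e i x * starRingEnd ℂ (e i x) ∂μ = 1
  inner_ne : ∀ i j, i ≠ j → ∫ x, e i x * starRingEnd ℂ (e j x) ∂μ = 0

variable {μ : Measure X} {e : ι → X → ℂ}

lemma coef_congr_ae {f g : X → ℂ} (h : f =ᵐ[μ] g) (i : ι) : coef μ e f i = coef μ e g i :=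
  integral_congr_ae (h.mono fun x hx => by simp only [hx])

lemma coef_smul (c : ℂ) (f : X → ℂ) (i : ι) : coef μ e (c • f) i = c * coef μ e f i := by
  simp only [coef, Pi.smul_apply, smul_eq_mul, mul_assoc]
  exact integral_const_mul _ _

namespace UnimodularSystem

lemma integrable_mul (he : UnimodularSystem μ e) {f : X → ℂ} (hf : Integrable f μ) (i : ι) :
    Integrable (fun x => f x * starRingEnd ℂ (e i x)) μ := by
  refine hf.mul_bdd (c := 1) ?_ (Filter.Eventually.of_forall fun x => ?_)
  · exact Complex.continuous_conj.comp_aestronglyMeasurable (he.meas i)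
  · simp [he.norm_eq i x]

lemma coef_add (he : UnimodularSystem μ e) {f g : X → ℂ} (hf : Integrable f μ)
    (hg : Integrable g μ) (i : ι) :
    coef μ e (f + g) i = coef μ e f i + coef μ e g i := by
  simp only [coef, Pi.add_apply, add_mul]
  exact integral_add (he.integrable_mul hf i) (he.integrable_mul hg i)

lemma enorm_coef_le (he : UnimodularSystem μ e) (f : X → ℂ) (i : ι) :
    ‖coef μ e f i‖ₑ ≤ ∫⁻ x, ‖f x‖ₑ ∂μ := by
  refine (enorm_integral_le_lintegral_enorm _).trans_eq ?_
  congr with x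
  have : ‖e i x‖ₑ = 1 := by rw [← ofReal_norm, he.norm_eq]; simp
  simp [enorm_mul, this]

variable [IsProbabilityMeasure μ]

lemma memLp (he : UnimodularSystem μ e) (i : ι) (p : ℝ≥0∞) : MemLp (e i) p μ :=
  MemLp.of_bound (he.meas i) 1 (Filter.Eventually.of_forall fun x => (he.norm_eq i x).le)

/-- The members of the system in `L²`. -/
def toL2 (he : UnimodularSystem μ e) (i : ι) : Lp ℂ 2 μ := (he.memLp i 2).toLp _

lemma inner_toL2 (he : UnimodularSystem μ e) {f : X → ℂ} (hf : MemLp f 2 μ) (i : ι) :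
    inner ℂ (he.toL2 i) (hf.toLp f) = coef μ e f i := by
  rw [L2.inner_def]
  refine integral_congr_ae ?_
  filter_upwards [hf.coeFn_toLp, (he.memLp i 2).coeFn_toLp] with x h1 h2
  simp [toL2, h1, h2]

lemma orthonormal (he : UnimodularSystem μ e) : Orthonormal ℂ he.toL2 := by
  classical
  rw [orthonormal_iff_ite]
  intro i j
  have h := he.inner_toL2 (he.memLp j 2) i
  change inner ℂ (he.toL2 i) (he.toL2 j) = _ at h
  rw [h]
  split_ifs with h
  · subst h; exact he.inner_self i
  · exact he.inner_ne j i (Ne.symm h)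

lemma tsum_enorm_coef_sq_le (he : UnimodularSystem μ e) {f : X → ℂ} (hf : MemLp f 2 μ) :
    ∑' i, ‖coef μ e f i‖ₑ ^ 2 ≤ ∫⁻ x, ‖f x‖ₑ ^ 2 ∂μ := by
  have h2 : ‖hf.toLp f‖ₑ = eLpNorm f 2 μ := by rw [Lp.enorm_toLp]
  rw [← eLpNorm_two_sq, ← h2]
  refine ENNReal.summable.tsum_le_of_sum_le fun s => ?_
  have := he.orthonormal.sum_inner_products_le (s := s) (hf.toLp f)
  simp only [he.inner_toL2 hf] at this
  simp only [← ofReal_norm, ← ENNReal.ofReal_pow (norm_nonneg _)]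
  rw [← ENNReal.ofReal_sum_of_nonneg fun i _ => by positivity]
  exact ENNReal.ofReal_le_ofReal this

end UnimodularSystem
end Coef

/-! ### Splitting a function at a height, and summing over dyadic heights -/

section Split
variable {X : Type*} [MeasurableSpace X] {ι : Type*} {μ : Measure X} {e : ι → X → ℂ}
  [IsProbabilityMeasure μ]

/-- Splitting `f` at height `t`: the large part is controlled by its `L¹` norm, the small part by
Bessel's inequality. -/
lemma UnimodularSystem.tsum_indicator_enorm_coef_sq_le (he : UnimodularSystem μ e) {f : X → ℂ}
    (hm : StronglyMeasurable f) (hf : Integrable f μ) (t : ℝ) (E : Set ι) :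
    ∑' i, E.indicator (fun i => ‖coef μ e f i‖ₑ ^ 2) i ≤
      2 * ((E.encard : ℕ∞) : ℝ≥0∞) * (∫⁻ x in {x | t < ‖f x‖}, ‖f x‖ₑ ∂μ) ^ 2 +
      2 * ∫⁻ x in {x | ‖f x‖ ≤ t}, ‖f x‖ₑ ^ 2 ∂μ := by
  classical
  have hG : MeasurableSet {x | t < ‖f x‖} := measurableSet_lt measurable_const hm.norm.measurable
  have hH : MeasurableSet {x | ‖f x‖ ≤ t} := measurableSet_le hm.norm.measurable measurable_const
  set g : X → ℂ := {x | t < ‖f x‖}.indicator f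
  set h : X → ℂ := {x | ‖f x‖ ≤ t}.indicator f
  have hfgh : f = g + h := by
    have : {x | ‖f x‖ ≤ t} = {x | t < ‖f x‖}ᶜ := by ext x; simp
    simp only [g, h, this]
    exact (Set.indicator_self_add_compl _ _).symm
  -- The truncated part is bounded, so Bessel applies to it although `f` is only integrable.
  have hh : MemLp h 2 μ := by
    refine MemLp.of_bound (hm.indicator hH).aestronglyMeasurable |t|
      (Filter.Eventually.of_forall fun x => ?_)
    simp only [h, Set.indicator_apply, Set.mem_ofPred_eq]
    split_ifs with hx
    · exact hx.trans (le_abs_self t)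
    · simp
  have hgi : Integrable g μ := hf.indicator hG
  have hhi : Integrable h μ := hf.indicator hH
  have hg1 : ∫⁻ x, ‖g x‖ₑ ∂μ = ∫⁻ x in {x | t < ‖f x‖}, ‖f x‖ₑ ∂μ := by
    rw [← lintegral_indicator hG]
    simp only [g, enorm_indicator_eq_indicator_enorm]
  have hh2 : ∫⁻ x, ‖h x‖ₑ ^ 2 ∂μ = ∫⁻ x in {x | ‖f x‖ ≤ t}, ‖f x‖ₑ ^ 2 ∂μ := by
    rw [← lintegral_indicator hH]
    congr with x
    by_cases hx : x ∈ {x | ‖f x‖ ≤ t} <;> simp [h, hx]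
  calc ∑' i, E.indicator (fun i => ‖coef μ e f i‖ₑ ^ 2) i
      ≤ ∑' i, (E.indicator (fun _ => 2 * (∫⁻ x, ‖g x‖ₑ ∂μ) ^ 2) i
          + 2 * ‖coef μ e h i‖ₑ ^ 2) := by
        refine ENNReal.tsum_le_tsum fun i => ?_
        by_cases hi : i ∈ E
        · simp only [hi, Set.indicator_of_mem]
          have : coef μ e f i = coef μ e g i + coef μ e h i := by
            conv_lhs => rw [hfgh]
            exact he.coef_add hgi hhi i
          rw [this]
          calc ‖coef μ e g i + coef μ e h i‖ₑ ^ 2 ≤ (‖coef μ e g i‖ₑ + ‖coef μ e h i‖ₑ) ^ 2 := by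
                gcongr; exact enorm_add_le _ _
            _ ≤ _ := add_sq_le_two_mul _ _
            _ ≤ _ := by gcongr; exact he.enorm_coef_le g i
        · simp [hi]
    _ = 2 * ((E.encard : ℕ∞) : ℝ≥0∞) * (∫⁻ x, ‖g x‖ₑ ∂μ) ^ 2
          + 2 * ∑' i, ‖coef μ e h i‖ₑ ^ 2 := by
        rw [ENNReal.tsum_add, ENNReal.tsum_mul_left, ← tsum_subtype, ENNReal.tsum_set_const]
        ring
    _ ≤ _ := by
        rw [← hg1, ← hh2]
        gcongr
        exact he.tsum_enorm_coef_sq_le hh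

end Split

section Levels
variable {X : Type*} [MeasurableSpace X] {μ : Measure X}

lemma enorm_rpow_eq_ofReal (z : ℂ) {p : ℝ} (hp : 0 ≤ p) : ‖z‖ₑ ^ p = ENNReal.ofReal (‖z‖ ^ p) := by
  rw [← ofReal_norm, ENNReal.ofReal_rpow_of_nonneg (norm_nonneg _) hp]

/-- Heights `2 ^ (-a k)`: the weighted `L²` norms of the parts of `f` below them. -/
lemma exists_tsum_lintegral_small_le {p a : ℝ} (ha : 0 < a) (hap : 2 - 2 / a = p) :
    ∃ c : ℝ≥0, ∀ {X : Type*} [MeasurableSpace X] {μ : Measure X} {f : X → ℂ},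
      StronglyMeasurable f →
      ∑' k : ℤ, ENNReal.ofReal (((2 : ℝ) ^ k) ^ (2 : ℝ)) *
        ∫⁻ x in {x | ‖f x‖ ≤ ((2 : ℝ) ^ k) ^ (-a)}, ‖f x‖ₑ ^ 2 ∂μ ≤ c * ∫⁻ x, ‖f x‖ₑ ^ p ∂μ := by
  obtain ⟨c, hc⟩ := exists_tsum_dyadic_le (b := 2) (by norm_num)
  refine ⟨c, fun {X _ μ f} hm => ?_⟩
  have hH (k : ℤ) : MeasurableSet {x | ‖f x‖ ≤ ((2 : ℝ) ^ k) ^ (-a)} :=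
    measurableSet_le hm.norm.measurable measurable_const
  have hme : Measurable fun x => ‖f x‖ₑ ^ 2 := hm.enorm.pow_const 2
  calc _ = ∑' k : ℤ, ∫⁻ x, ENNReal.ofReal (((2 : ℝ) ^ k) ^ (2 : ℝ)) *
            {x | ‖f x‖ ≤ ((2 : ℝ) ^ k) ^ (-a)}.indicator (fun x => ‖f x‖ₑ ^ 2) x ∂μ := by
        congr with k
        rw [lintegral_const_mul _ (hme.indicator (hH k)), lintegral_indicator (hH k)]
    _ = ∫⁻ x, ∑' k : ℤ, ENNReal.ofReal (((2 : ℝ) ^ k) ^ (2 : ℝ)) *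
            {x | ‖f x‖ ≤ ((2 : ℝ) ^ k) ^ (-a)}.indicator (fun x => ‖f x‖ₑ ^ 2) x ∂μ :=
        (lintegral_tsum fun k => ((hme.indicator (hH k)).const_mul _).aemeasurable).symm
    _ ≤ ∫⁻ x, c * ‖f x‖ₑ ^ p ∂μ := by
        refine lintegral_mono fun x => ?_
        by_cases hx : f x = 0
        · simp [Set.indicator_apply, hx]
        have hy : 0 < ‖f x‖ := norm_pos_iff.2 hx
        calc _ ≤ ∑' k : ℤ, (if (2 : ℝ) ^ k ≤ ‖f x‖ ^ (-a⁻¹) then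
                ENNReal.ofReal (((2 : ℝ) ^ k) ^ (2 : ℝ)) else 0) * ‖f x‖ₑ ^ 2 := by
              refine ENNReal.tsum_le_tsum fun k => ?_
              by_cases hk : ‖f x‖ ≤ ((2 : ℝ) ^ k) ^ (-a)
              · have hk2 : (2 : ℝ) ^ k ≤ ‖f x‖ ^ (-a⁻¹) := by
                  have := Real.rpow_le_rpow_of_nonpos hy hk (z := -a⁻¹)
                    (by have := inv_pos.2 ha; linarith)
                  rwa [← Real.rpow_mul (by positivity), neg_mul_neg, mul_inv_cancel₀ ha.ne',
                    Real.rpow_one] at this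
                simp [hk, hk2]
              · simp [hk]
          -- At each point the dyadic sum is of order `‖f x‖ ^ (-2/a)`; multiplied by `‖f x‖ ^ 2` it
          -- gives exponent `2 - 2/a = p`.
          _ ≤ c * ENNReal.ofReal ((‖f x‖ ^ (-a⁻¹)) ^ (2 : ℝ)) * ‖f x‖ₑ ^ 2 := by
              rw [ENNReal.tsum_mul_right]
              gcongr
              exact hc _ (by positivity)
          _ = c * ‖f x‖ₑ ^ p := by
              rw [mul_assoc, ← ofReal_norm, ← ENNReal.ofReal_pow hy.le,
                ← ENNReal.ofReal_mul (by positivity), ENNReal.ofReal_rpow_of_pos hy,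
                ← Real.rpow_mul hy.le, ← Real.rpow_natCast, ← Real.rpow_add hy]
              congr 3
              rw [← hap]; push_cast; ring
    _ = _ := lintegral_const_mul _ (hm.enorm.pow_const p)

/-- Heights `2 ^ (-a k)`: the weighted `L¹` norms of the parts of `f` above them. -/
lemma exists_tsum_lintegral_large_le {p a : ℝ} (hp : 1 < p) (ha : 0 < a) :
    ∃ c : ℝ≥0, ∀ {X : Type*} [MeasurableSpace X] {μ : Measure X} {f : X → ℂ},
      StronglyMeasurable f →
      ∑' k : ℤ, ENNReal.ofReal ((((2 : ℝ) ^ k) ^ (-a)) ^ (p - 1)) *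
        ∫⁻ x in {x | ((2 : ℝ) ^ k) ^ (-a) < ‖f x‖}, ‖f x‖ₑ ∂μ ≤ c * ∫⁻ x, ‖f x‖ₑ ^ p ∂μ := by
  obtain ⟨c, hc⟩ := exists_tsum_dyadic_le (b := a * (p - 1)) (mul_pos ha (by linarith))
  refine ⟨c, fun {X _ μ f} hm => ?_⟩
  have hH (k : ℤ) : MeasurableSet {x | ((2 : ℝ) ^ k) ^ (-a) < ‖f x‖} :=
    measurableSet_lt measurable_const hm.norm.measurable
  calc _ = ∑' k : ℤ, ∫⁻ x, ENNReal.ofReal ((((2 : ℝ) ^ k) ^ (-a)) ^ (p - 1)) *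
            {x | ((2 : ℝ) ^ k) ^ (-a) < ‖f x‖}.indicator (fun x => ‖f x‖ₑ) x ∂μ := by
        congr with k
        rw [lintegral_const_mul _ (hm.enorm.indicator (hH k)), lintegral_indicator (hH k)]
    _ = ∫⁻ x, ∑' k : ℤ, ENNReal.ofReal ((((2 : ℝ) ^ k) ^ (-a)) ^ (p - 1)) *
            {x | ((2 : ℝ) ^ k) ^ (-a) < ‖f x‖}.indicator (fun x => ‖f x‖ₑ) x ∂μ :=
        (lintegral_tsum fun k => ((hm.enorm.indicator (hH k)).const_mul _).aemeasurable).symm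
    _ ≤ ∫⁻ x, c * ‖f x‖ₑ ^ p ∂μ := by
        refine lintegral_mono fun x => ?_
        by_cases hx : f x = 0
        · simp [Set.indicator_apply, hx]
        have hy : 0 < ‖f x‖ := norm_pos_iff.2 hx
        -- The heights decrease in `k`; reversing the sign turns the condition into an upper bound
        -- on `2 ^ k`, as the dyadic lemma requires.
        rw [← (Equiv.neg ℤ).tsum_eq]
        calc _ ≤ ∑' k : ℤ, (if (2 : ℝ) ^ k ≤ ‖f x‖ ^ a⁻¹ then
                ENNReal.ofReal (((2 : ℝ) ^ k) ^ (a * (p - 1))) else 0) * ‖f x‖ₑ := by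
              refine ENNReal.tsum_le_tsum fun k => ?_
              have h1 : ((2 : ℝ) ^ (-k)) ^ (-a) = ((2 : ℝ) ^ k) ^ a := by
                rw [zpow_neg, Real.inv_rpow (by positivity), Real.rpow_neg (by positivity), inv_inv]
              simp only [Equiv.neg_apply, h1]
              by_cases hk : ((2 : ℝ) ^ k) ^ a < ‖f x‖
              · have hk2 : (2 : ℝ) ^ k ≤ ‖f x‖ ^ a⁻¹ := by
                  have := Real.rpow_le_rpow (by positivity) hk.le (z := a⁻¹) (by positivity)
                  rwa [← Real.rpow_mul (by positivity), mul_inv_cancel₀ ha.ne',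
                    Real.rpow_one] at this
                simp [hk, hk2, Real.rpow_mul (show (0 : ℝ) ≤ 2 ^ k by positivity)]
              · simp [hk]
          _ ≤ c * ENNReal.ofReal ((‖f x‖ ^ a⁻¹) ^ (a * (p - 1))) * ‖f x‖ₑ := by
              rw [ENNReal.tsum_mul_right]
              gcongr
              exact hc _ (by positivity)
          _ = c * ‖f x‖ₑ ^ p := by
              rw [mul_assoc, ← ofReal_norm,
                ← ENNReal.ofReal_mul (by positivity), ENNReal.ofReal_rpow_of_pos hy,
                ← Real.rpow_mul hy.le, ← mul_assoc, inv_mul_cancel₀ ha.ne', one_mul,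
                ← Real.rpow_add_one hy.ne', sub_add_cancel]
    _ = _ := lintegral_const_mul _ (hm.enorm.pow_const p)

/-- Chebyshev: `t ^ (p - 1) * ‖f‖ ≤ ‖f‖ ^ p` wherever `‖f‖ > t`. It serves to linearize a square of
the left side when the right side is 1. -/
lemma ofReal_rpow_mul_lintegral_le {p : ℝ} (hp : 1 < p) {f : X → ℂ} (hm : StronglyMeasurable f)
    {t : ℝ} (ht : 0 < t) :
    ENNReal.ofReal (t ^ (p - 1)) * ∫⁻ x in {x | t < ‖f x‖}, ‖f x‖ₑ ∂μ ≤ ∫⁻ x, ‖f x‖ₑ ^ p ∂μ := by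
  have hH : MeasurableSet {x | t < ‖f x‖} := measurableSet_lt measurable_const hm.norm.measurable
  rw [← lintegral_const_mul _ hm.enorm]
  refine le_trans (setLIntegral_mono' hH fun x hx => ?_) (setLIntegral_le_lintegral _ _)
  have hx' : t < ‖f x‖ := hx
  rw [enorm_rpow_eq_ofReal _ (by linarith), ← ofReal_norm, ← ENNReal.ofReal_mul (by positivity)]
  apply ENNReal.ofReal_le_ofReal
  calc t ^ (p - 1) * ‖f x‖ ≤ ‖f x‖ ^ (p - 1) * ‖f x‖ := by
        gcongr
    _ = ‖f x‖ ^ p := by rw [← Real.rpow_add_one (ht.trans hx').ne', sub_add_cancel]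

end Levels

/-! ### The Paley–Hörmander inequality -/

/-- The Paley–Hörmander inequality with both norms normalized. -/
lemma exists_tsum_le_of_normalized {p : ℝ} (hp : 1 < p) (hp2 : p < 2) :
    ∃ C : ℝ≥0, ∀ {X : Type*} [MeasurableSpace X] {ι : Type*} {μ : Measure X}
      [IsProbabilityMeasure μ] {e : ι → X → ℂ}, UnimodularSystem μ e →
      ∀ {σ : ι → ℂ}, (∀ s : ℝ, 0 < s → (({i | s ≤ ‖σ i‖}.encard : ℕ∞) : ℝ≥0∞) ≤
        ENNReal.ofReal (s ^ (-(2 * p / (2 - p))))) →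
      ∀ {f : X → ℂ}, StronglyMeasurable f → Integrable f μ → ∫⁻ x, ‖f x‖ₑ ^ p ∂μ = 1 →
      ∑' i, (‖σ i‖ₑ * ‖coef μ e f i‖ₑ) ^ 2 ≤ C := by
  have h2p : 0 < 2 - p := by linarith
  -- This value meets both demands: `2 - 2/a = p` for the small parts, and `2 - 2p/(2-p) =
  -- -2a(p-1)`, which is `hw`, for the large parts.
  set a : ℝ := 2 / (2 - p) with ha_def
  have ha : 0 < a := by positivity
  obtain ⟨c₁, hc₁⟩ := exists_tsum_lintegral_small_le (p := p) (a := a) ha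
    (by rw [ha_def]; field_simp; ring)
  obtain ⟨c₂, hc₂⟩ := exists_tsum_lintegral_large_le (p := p) (a := a) hp ha
  refine ⟨8 * c₂ + 8 * c₁, fun {X _ ι μ _ e} he {σ} hσ {f} hm hf hF => ?_⟩
  set E : ℤ → Set ι := fun k => {i | (2 : ℝ) ^ k ≤ ‖σ i‖ ∧ ‖σ i‖ < (2 : ℝ) ^ (k + 1)}
  set t : ℤ → ℝ := fun k => ((2 : ℝ) ^ k) ^ (-a)
  have ht : ∀ k, 0 < t k := fun k => by positivity
  set G : ℤ → ℝ≥0∞ := fun k => ∫⁻ x in {x | t k < ‖f x‖}, ‖f x‖ₑ ∂μ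
  set H : ℤ → ℝ≥0∞ := fun k => ∫⁻ x in {x | ‖f x‖ ≤ t k}, ‖f x‖ₑ ^ 2 ∂μ
  set w : ℤ → ℝ≥0∞ := fun k => ENNReal.ofReal (((2 : ℝ) ^ k) ^ (2 : ℝ))
  have hw : ∀ k, w k * ENNReal.ofReal (((2 : ℝ) ^ k) ^ (-(2 * p / (2 - p)))) =
      ENNReal.ofReal (t k ^ (p - 1)) ^ 2 := fun k => by
    have h2 : (0 : ℝ) < 2 ^ k := by positivity
    rw [← ENNReal.ofReal_mul (by positivity), ← ENNReal.ofReal_pow (by positivity),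
      ← Real.rpow_natCast, ← Real.rpow_mul (ht k).le, ← Real.rpow_mul h2.le, ← Real.rpow_add h2]
    congr 2
    rw [ha_def]; field_simp; push_cast; ring
  calc ∑' i, (‖σ i‖ₑ * ‖coef μ e f i‖ₑ) ^ 2
      ≤ ∑' i, ∑' k, 4 * w k * (E k).indicator (fun i => ‖coef μ e f i‖ₑ ^ 2) i := by
        refine ENNReal.tsum_le_tsum fun i => ?_
        by_cases hi : σ i = 0
        · simp [hi]
        obtain ⟨k, hk1, hk2⟩ := exists_mem_Ico_zpow (norm_pos_iff.2 hi) (one_lt_two (α := ℝ))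
        refine le_trans ?_ (ENNReal.le_tsum k)
        have hik : i ∈ E k := ⟨hk1, hk2⟩
        rw [Set.indicator_of_mem hik, mul_pow]
        gcongr
        rw [← ofReal_norm, ← ENNReal.ofReal_pow (norm_nonneg _)]
        have h4 : (4 : ℝ≥0∞) = ENNReal.ofReal 4 := by simp
        rw [h4, ← ENNReal.ofReal_mul (by norm_num)]
        apply ENNReal.ofReal_le_ofReal
        rw [zpow_add_one₀ two_ne_zero] at hk2
        rw [Real.rpow_two]
        nlinarith [norm_nonneg (σ i)]
    _ = ∑' k, 4 * w k * ∑' i, (E k).indicator (fun i => ‖coef μ e f i‖ₑ ^ 2) i := by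
        rw [ENNReal.tsum_comm]
        simp_rw [ENNReal.tsum_mul_left]
    _ ≤ ∑' k, (8 * (ENNReal.ofReal (t k ^ (p - 1)) * G k) + 8 * (w k * H k)) := by
        refine ENNReal.tsum_le_tsum fun k => ?_
        -- The large part enters squared. By the normalization one of its two factors is at most 1,
        -- leaving a linear quantity that can be summed over `k`.
        have hG1 : ENNReal.ofReal (t k ^ (p - 1)) * G k ≤ 1 :=
          hF ▸ ofReal_rpow_mul_lintegral_le hp hm (ht k)
        have hcard : (((E k).encard : ℕ∞) : ℝ≥0∞) ≤
            ENNReal.ofReal (((2 : ℝ) ^ k) ^ (-(2 * p / (2 - p)))) := by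
          refine le_trans ?_ (hσ ((2 : ℝ) ^ k) (by positivity))
          have : (E k).encard ≤ {i | (2 : ℝ) ^ k ≤ ‖σ i‖}.encard :=
            Set.encard_le_encard fun i hi => hi.1
          exact_mod_cast this
        calc _ ≤ 4 * w k * (2 * ((E k).encard : ℕ∞) * G k ^ 2 + 2 * H k) := by
              gcongr
              exact he.tsum_indicator_enorm_coef_sq_le hm hf (t k) (E k)
          _ ≤ 4 * w k * (2 * ENNReal.ofReal (((2 : ℝ) ^ k) ^ (-(2 * p / (2 - p)))) * G k ^ 2
                + 2 * H k) := by gcongr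
          _ = 8 * ((w k * ENNReal.ofReal (((2 : ℝ) ^ k) ^ (-(2 * p / (2 - p))))) * G k ^ 2)
                + 8 * (w k * H k) := by ring
          _ = 8 * ((ENNReal.ofReal (t k ^ (p - 1)) * G k) * (ENNReal.ofReal (t k ^ (p - 1)) * G k))
                + 8 * (w k * H k) := by rw [hw]; ring
          _ ≤ 8 * ((ENNReal.ofReal (t k ^ (p - 1)) * G k) * 1) + 8 * (w k * H k) := by gcongr
          _ = _ := by rw [mul_one]
    _ ≤ 8 * (c₂ * 1) + 8 * (c₁ * 1) := by
        rw [ENNReal.tsum_add, ENNReal.tsum_mul_left, ENNReal.tsum_mul_left, ← hF]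
        gcongr
        · exact hc₂ hm
        · exact hc₁ hm
    _ = _ := by push_cast; ring

lemma eLpNorm_ofReal_rpow {X : Type*} [MeasurableSpace X] {μ : Measure X} {p : ℝ} (hp : 0 < p)
    (f : X → ℂ) : eLpNorm f (ENNReal.ofReal p) μ ^ p = ∫⁻ x, ‖f x‖ₑ ^ p ∂μ := by
  have h := eLpNorm_nnreal_pow_eq_lintegral (f := f) (μ := μ) (p := p.toNNReal)
    (by simpa using hp)
  rw [Real.coe_toNNReal _ hp.le] at h
  exact h

/-- The Paley–Hörmander inequality. -/
theorem exists_tsum_le {p : ℝ} (hp : 1 < p) (hp2 : p ≤ 2) :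
    ∃ C : ℝ≥0, ∀ {X : Type*} [MeasurableSpace X] {ι : Type*} {μ : Measure X}
      [IsProbabilityMeasure μ] {e : ι → X → ℂ}, UnimodularSystem μ e →
      ∀ {σ : ι → ℂ}, weakSup σ (1 / p - 1 / 2) < ⊤ →
      ∀ {f : X → ℂ}, MemLp f (ENNReal.ofReal p) μ →
      ∑' i, (‖σ i‖ₑ * ‖coef μ e f i‖ₑ) ^ 2 ≤
        (C * weakSup σ (1 / p - 1 / 2) * eLpNorm f (ENNReal.ofReal p) μ) ^ 2 := by
  have hp0 : 0 < p := by linarith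
  have hexp : 0 ≤ 1 / p - 1 / 2 := sub_nonneg.2 (one_div_le_one_div_of_le hp0 hp2)
  rcases hp2.eq_or_lt with rfl | hp2
  -- At `p = 2` the weak exponent is 0, `σ` is bounded, and Bessel suffices.
  · refine ⟨1, fun {X _ ι μ _ e} he {σ} hσ {f} hf => ?_⟩
    have h2 : ENNReal.ofReal 2 = 2 := by simp
    rw [h2] at hf ⊢
    rw [ENNReal.coe_one, one_mul, mul_pow, eLpNorm_two_sq]
    refine le_trans ?_ (mul_le_mul_right (he.tsum_enorm_coef_sq_le hf) _)
    rw [← ENNReal.tsum_mul_left]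
    refine ENNReal.tsum_le_tsum fun i => ?_
    rw [mul_pow]
    gcongr
    exact enorm_le_weakSup hexp i
  · obtain ⟨C, hC⟩ := exists_tsum_le_of_normalized hp hp2
    -- The normalized bound has `C` where a square is wanted; `C ≤ (C + 1) ^ 2` avoids a square
    -- root.
    refine ⟨C + 1, fun {X _ ι μ _ e} he {σ} hσ {f} hf => ?_⟩
    have h2p : 0 < 2 - p := by linarith
    by_cases hf0 : eLpNorm f (ENNReal.ofReal p) μ = 0
    · have hz : f =ᵐ[μ] 0 :=
        (eLpNorm_eq_zero_iff hf.1 (by simpa using hp0)).1 hf0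
      have : ∀ i, coef μ e f i = 0 := fun i => by
        rw [coef_congr_ae hz i]; simp [coef]
      simp [this]
    by_cases hM0 : weakSup σ (1 / p - 1 / 2) = 0
    · have : ∀ i, ‖σ i‖ₑ = 0 := fun i => le_antisymm (hM0 ▸ enorm_le_weakSup hexp i) zero_le
      simp [this]
    set M := weakSup σ (1 / p - 1 / 2) with hM
    set F := eLpNorm f (ENNReal.ofReal p) μ with hF
    have hFt : F ≠ ⊤ := hf.2.ne
    have hN : 0 < M.toReal := ENNReal.toReal_pos hM0 hσ.ne
    have hFr : 0 < F.toReal := ENNReal.toReal_pos hf0 hFt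
    set g : X → ℂ := hf.1.mk f
    have hfg : f =ᵐ[μ] g := hf.1.ae_eq_mk
    have hg : StronglyMeasurable g := hf.1.stronglyMeasurable_mk
    have hgi : Integrable g μ :=
      ((memLp_congr_ae hfg).1 hf).integrable (by simpa using hp.le)
    have hFinv : ‖((F.toReal : ℂ))⁻¹‖ₑ = F⁻¹ := by
      rw [enorm_inv (by exact_mod_cast hFr.ne'), ← ofReal_norm]
      simp [ENNReal.ofReal_toReal hFt]
    have hMinv : ‖((M.toReal : ℂ))⁻¹‖ₑ = M⁻¹ := by
      rw [enorm_inv (by exact_mod_cast hN.ne'), ← ofReal_norm]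
      simp [ENNReal.ofReal_toReal hσ.ne]
    -- Both sides are homogeneous in `σ` and in `f`, so the normalized case applies to `σ / M` and
    -- to `g / F`, with `g` a strongly measurable representative of `f`.
    have key := hC he (σ := fun i => (M.toReal : ℂ)⁻¹ * σ i) (fun s hs => ?_)
      (f := (F.toReal : ℂ)⁻¹ • g) (hg.const_smul _) (hgi.smul _) ?_
    · calc ∑' i, (‖σ i‖ₑ * ‖coef μ e f i‖ₑ) ^ 2
          = ∑' i, (M * F) ^ 2 * (‖(M.toReal : ℂ)⁻¹ * σ i‖ₑ *
              ‖coef μ e ((F.toReal : ℂ)⁻¹ • g) i‖ₑ) ^ 2 := by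
            refine tsum_congr fun i => ?_
            rw [coef_smul, enorm_mul, enorm_mul, hFinv, hMinv, coef_congr_ae hfg i, ← mul_pow]
            congr 1
            calc _ = (M * M⁻¹) * (F * F⁻¹) * (‖σ i‖ₑ * ‖coef μ e g i‖ₑ) := by
                  rw [ENNReal.mul_inv_cancel hM0 hσ.ne, ENNReal.mul_inv_cancel hf0 hFt]; simp
              _ = _ := by ring
        _ ≤ (M * F) ^ 2 * C := by rw [ENNReal.tsum_mul_left]; gcongr
        _ ≤ (M * F) ^ 2 * (C + 1) ^ 2 := by
            gcongr
            calc (C : ℝ≥0∞) ≤ (C + 1) * 1 := by simp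
              _ ≤ (C + 1) * (C + 1) := by gcongr; exact le_add_self
              _ = _ := (sq _).symm
        _ = _ := by push_cast; ring
    · have := encard_le_of_weakSup_le (σ := σ) (r := 2 * p / (2 - p)) (by positivity) hN
        (by rw [ENNReal.ofReal_toReal hσ.ne, hM]
            apply le_of_eq
            congr 1
            field_simp) hs
      have hset : {i | s ≤ ‖(M.toReal : ℂ)⁻¹ * σ i‖} = {i | M.toReal * s ≤ ‖σ i‖} := by
        ext i
        simp only [Set.mem_ofPred_eq]
        rw [norm_mul, norm_inv, Complex.norm_real, Real.norm_of_nonneg hN.le,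
          ← div_eq_inv_mul, le_div_iff₀' hN]
      rwa [hset]
    · rw [← eLpNorm_ofReal_rpow hp0, eLpNorm_const_smul, hFinv, ← eLpNorm_congr_ae hfg, ← hF,
        ENNReal.inv_mul_cancel hf0 hFt, ENNReal.one_rpow]

/-! ### Duality -/

/-- The dual form: synthesis from `ℓ²` into `L^q` for `q ≥ 2`. -/
theorem exists_eLpNorm_sum_le {q : ℝ} (hq : 2 ≤ q) :
    ∃ C : ℝ≥0, ∀ {X : Type*} [MeasurableSpace X] {ι : Type*} {μ : Measure X}
      [IsProbabilityMeasure μ] {e : ι → X → ℂ}, UnimodularSystem μ e →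
      ∀ {σ : ι → ℂ}, weakSup σ (1 / q.conjExponent - 1 / 2) < ⊤ →
      ∀ (b : ι → ℂ) (S : Finset ι),
      eLpNorm (fun x => ∑ i ∈ S, σ i * b i * e i x) (ENNReal.ofReal q) μ ≤
        C * weakSup σ (1 / q.conjExponent - 1 / 2) * (∑ i ∈ S, ‖b i‖ₑ ^ 2) ^ (2⁻¹ : ℝ) := by
  have hq1 : 1 < q := by linarith
  have hq0 : 0 < q := by linarith
  have hc := Real.HolderConjugate.conjExponent hq1
  obtain ⟨C, hC⟩ := exists_tsum_le (p := q.conjExponent) hc.symm.lt (by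
    rw [Real.conjExponent, div_le_iff₀ (by linarith)]; linarith)
  refine ⟨C, fun {X _ ι μ _ e} he {σ} hσ b S => ?_⟩
  set M := weakSup σ (1 / q.conjExponent - 1 / 2)
  set P : X → ℂ := fun x => ∑ i ∈ S, σ i * b i * e i x with hP
  have hPm : AEStronglyMeasurable P μ := by
    refine Finset.aestronglyMeasurable_fun_sum _ fun i _ => (he.meas i).const_mul _
  set B : ℝ := ∑ i ∈ S, ‖σ i * b i‖
  have hPB : ∀ x, ‖P x‖ ≤ B := fun x => (norm_sum_le _ _).trans
    (Finset.sum_le_sum fun i _ => by simp [he.norm_eq i x])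
  -- The extremal function for Hölder: `g * conj P = |P| ^ q` and `|g| ^ q' = |P| ^ q`.
  set g : X → ℂ := fun x => ((‖P x‖ ^ (q - 2) : ℝ) : ℂ) * P x with hg
  have hgn : ∀ x, ‖g x‖ = ‖P x‖ ^ (q - 1) := fun x => by
    rw [hg, norm_mul, Complex.norm_real, Real.norm_of_nonneg (by positivity)]
    rcases (norm_nonneg (P x)).eq_or_lt with h0 | h0
    · rw [← h0, mul_zero, Real.zero_rpow (by linarith)]
    · rw [← Real.rpow_add_one h0.ne']; congr 1; ring
  have hgm : AEStronglyMeasurable g μ := by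
    refine AEStronglyMeasurable.mul ?_ hPm
    exact (Complex.continuous_ofReal.comp
      (Real.continuous_rpow_const (by linarith))).comp_aestronglyMeasurable hPm.norm
  have hgL : ∀ r, MemLp g r μ := fun r => by
    refine MemLp.of_bound hgm (B ^ (q - 1)) (Filter.Eventually.of_forall fun x => ?_)
    rw [hgn]
    exact Real.rpow_le_rpow (norm_nonneg _) (hPB x) (by linarith)
  have hPL : MemLp P (ENNReal.ofReal q) μ :=
    MemLp.of_bound hPm B (Filter.Eventually.of_forall hPB)
  set I : ℝ≥0∞ := ∫⁻ x, ‖P x‖ₑ ^ q ∂μ with hI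
  have hPI : eLpNorm P (ENNReal.ofReal q) μ = I ^ q⁻¹ := by
    rw [hI, ← eLpNorm_ofReal_rpow hq0, ← ENNReal.rpow_mul, mul_inv_cancel₀ hq0.ne',
      ENNReal.rpow_one]
  have hgI : eLpNorm g (ENNReal.ofReal q.conjExponent) μ = I ^ q.conjExponent⁻¹ := by
    have h : ∫⁻ x, ‖g x‖ₑ ^ q.conjExponent ∂μ = I := by
      refine lintegral_congr fun x => ?_
      rw [enorm_rpow_eq_ofReal _ hc.symm.nonneg, enorm_rpow_eq_ofReal _ hq0.le, hgn,
        ← Real.rpow_mul (norm_nonneg _), hc.sub_one_mul_conj]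
    rw [← h, ← eLpNorm_ofReal_rpow hc.symm.pos, ← ENNReal.rpow_mul,
      mul_inv_cancel₀ hc.symm.pos.ne', ENNReal.rpow_one]
  have hpair : I ≤ ∑ i ∈ S, ‖b i‖ₑ * (‖σ i‖ₑ * ‖coef μ e g i‖ₑ) := by
    have h1 : ∫ x, g x * starRingEnd ℂ (P x) ∂μ = ((∫ x, ‖P x‖ ^ q ∂μ : ℝ) : ℂ) := by
      rw [← integral_complex_ofReal]
      congr with x
      simp only [hg, mul_assoc, Complex.mul_conj, Complex.normSq_eq_norm_sq]
      rw [← Complex.ofReal_mul]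
      congr 1
      rcases (norm_nonneg (P x)).eq_or_lt with h0 | h0
      · rw [← h0, Real.zero_rpow hq0.ne']; simp
      · rw [← Real.rpow_natCast, ← Real.rpow_add h0]; congr 1; push_cast; ring
    have h2 : ∫ x, g x * starRingEnd ℂ (P x) ∂μ =
        ∑ i ∈ S, starRingEnd ℂ (σ i * b i) * coef μ e g i := by
      simp only [hP, map_sum, Finset.mul_sum, coef]
      rw [integral_finsetSum]
      · refine Finset.sum_congr rfl fun i _ => ?_
        rw [← integral_const_mul]
        congr with x
        simp only [map_mul]; ring
      · intro i _
        have := (he.integrable_mul ((hgL 1).integrable le_rfl) i).const_mul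
          (starRingEnd ℂ (σ i * b i))
        refine this.congr (Filter.Eventually.of_forall fun x => ?_)
        simp only [map_mul]; ring
    have h3 : I = ‖∫ x, g x * starRingEnd ℂ (P x) ∂μ‖ₑ := by
      rw [h1, ← ofReal_norm, Complex.norm_real, Real.norm_of_nonneg (by positivity),
        ofReal_integral_eq_lintegral_ofReal]
      · simp only [hI, enorm_rpow_eq_ofReal _ hq0.le]
      · refine Integrable.of_bound (C := B ^ q) ?_ (Filter.Eventually.of_forall fun x => ?_)
        · exact (Real.continuous_rpow_const hq0.le).comp_aestronglyMeasurable hPm.norm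
        · rw [Real.norm_of_nonneg (by positivity)]
          exact Real.rpow_le_rpow (norm_nonneg _) (hPB x) hq0.le
      · exact Filter.Eventually.of_forall fun x => by positivity
    rw [h3, h2]
    refine (enorm_sum_le _ _).trans_eq (Finset.sum_congr rfl fun i _ => ?_)
    simp only [enorm_mul, map_mul, RCLike.enorm_conj]
    ring
  set K := C * M * (∑ i ∈ S, ‖b i‖ₑ ^ 2) ^ (2⁻¹ : ℝ)
  have hIK : I ≤ K * I ^ q.conjExponent⁻¹ := by
    -- Cauchy–Schwarz separates `b` from the weighted coefficients of `g`, which the Paley–Hörmander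
    -- inequality at `q'` controls.
    refine hpair.trans ((ENNReal.inner_le_Lp_mul_Lq S _ _ (p := 2) (q := 2)
      Real.HolderConjugate.two_two).trans ?_)
    have h4 : (∑ i ∈ S, (‖σ i‖ₑ * ‖coef μ e g i‖ₑ) ^ (2 : ℝ)) ^ (1 / (2 : ℝ)) ≤
        C * M * I ^ q.conjExponent⁻¹ := by
      have h5 := (ENNReal.sum_le_tsum S).trans (hC he hσ (hgL _))
      rw [hgI] at h5
      change _ ≤ (C * M * _) ^ 2 at h5
      have h6 := ENNReal.rpow_le_rpow h5 (z := 1 / 2) (by norm_num)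
      rw [← ENNReal.rpow_natCast (C * _ * _), ← ENNReal.rpow_mul] at h6
      norm_num at h6 ⊢
      exact h6
    calc _ ≤ (∑ i ∈ S, ‖b i‖ₑ ^ 2) ^ (2⁻¹ : ℝ) * (C * M * I ^ q.conjExponent⁻¹) := by
          refine mul_le_mul' (le_of_eq ?_) h4
          norm_num
      _ = _ := by ring
  have hIt : I ≠ ⊤ := by
    intro h
    have := hPL.2
    rw [hPI, h, ENNReal.top_rpow_of_pos (by positivity)] at this
    exact absurd this (lt_irrefl _)
  rw [hPI]
  by_cases hI0 : I = 0
  · rw [hI0, ENNReal.zero_rpow_of_pos (by positivity)]; exact zero_le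
  have hne : I ^ q.conjExponent⁻¹ ≠ 0 := by
    simp [ENNReal.rpow_eq_zero_iff, hI0, hIt]
  have hnt : I ^ q.conjExponent⁻¹ ≠ ⊤ := ENNReal.rpow_ne_top_of_nonneg hc.symm.inv_nonneg hIt
  -- Dividing `I ≤ K * I ^ (1/q')` by its last factor, nonzero and finite, leaves `I ^ (1/q) ≤ K`.
  refine (ENNReal.mul_le_mul_iff_left hne hnt).1 ?_
  rwa [← ENNReal.rpow_add _ _ hI0 hIt, hc.inv_add_inv_eq_one, ENNReal.rpow_one]

/-! ### Convergence of the multiplier series -/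

/-- A family of linear maps whose finite sums are dominated by square summable quantities sums to a
bounded linear map. -/
lemma exists_linearMap_hasSum {V W ι : Type*} [NormedAddCommGroup V] [NormedSpace ℂ V]
    [NormedAddCommGroup W] [NormedSpace ℂ W] [CompleteSpace W] (w : ι → V →ₗ[ℂ] W)
    (γ : ι → V → ℝ) {D K : ℝ} (hD : 0 ≤ D) (hK : 0 ≤ K)
    (hγ : ∀ u (S : Finset ι), ∑ i ∈ S, γ i u ^ 2 ≤ (K * ‖u‖) ^ 2)
    (hw : ∀ u (S : Finset ι), ‖∑ i ∈ S, w i u‖ ≤ D * √(∑ i ∈ S, γ i u ^ 2)) :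
    ∃ T : V →ₗ[ℂ] W, (∀ u, HasSum (fun i => w i u) (T u)) ∧ ∀ u, ‖T u‖ ≤ D * K * ‖u‖ := by
  have hsum : ∀ u, Summable fun i => w i u := fun u => by
    have h1 : Summable fun i => γ i u ^ 2 := summable_of_sum_le (fun i => sq_nonneg _) (hγ u)
    rw [summable_iff_vanishing_norm] at h1 ⊢
    intro ε hε
    obtain ⟨s, hs⟩ := h1 ((ε / (D + 1)) ^ 2) (by positivity)
    refine ⟨s, fun t ht => (hw u t).trans_lt ?_⟩
    have h2 := hs t ht
    rw [Real.norm_of_nonneg (Finset.sum_nonneg fun i _ => sq_nonneg _)] at h2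
    have h3 : √(∑ i ∈ t, γ i u ^ 2) < ε / (D + 1) := (Real.sqrt_lt' (by positivity)).2 h2
    -- `D + 1` replaces `D` so that the division makes sense when `D = 0`.
    calc D * √(∑ i ∈ t, γ i u ^ 2) ≤ (D + 1) * √(∑ i ∈ t, γ i u ^ 2) := by gcongr; linarith
      _ < (D + 1) * (ε / (D + 1)) := by gcongr
      _ = ε := by field_simp
  refine ⟨{ toFun := fun u => ∑' i, w i u
            map_add' := fun u v => by
              simp only [map_add]; exact (hsum u).tsum_add (hsum v)
            map_smul' := fun c u => by
              simp only [map_smul, RingHom.id_apply]; exact (hsum u).tsum_const_smul c },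
    fun u => (hsum u).hasSum, fun u => ?_⟩
  refine le_of_tendsto ((hsum u).hasSum.norm) (Filter.Eventually.of_forall fun S => ?_)
  refine (hw u S).trans ?_
  rw [mul_assoc]
  gcongr
  rw [← Real.sqrt_sq (show 0 ≤ K * ‖u‖ by positivity)]
  exact Real.sqrt_le_sqrt (hγ u S)

section
variable {X : Type*} [MeasurableSpace X] {ι : Type*} {μ : Measure X} {e : ι → X → ℂ}
  [IsProbabilityMeasure μ]

namespace UnimodularSystem

lemma coeFn_sum_toLp (he : UnimodularSystem μ e) (r : ℝ≥0∞) (c : ι → ℂ) (S : Finset ι) :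
    (∑ i ∈ S, c i • (he.memLp i r).toLp (e i) : Lp ℂ r μ) =ᵐ[μ]
      fun x => ∑ i ∈ S, c i * e i x := by
  have h1 : MemLp (fun x => ∑ i ∈ S, c i * e i x) r μ :=
    memLp_finsetSum S fun i _ => (he.memLp i r).const_mul (c i)
  have h2 : (∑ i ∈ S, c i • (he.memLp i r).toLp (e i) : Lp ℂ r μ) = h1.toLp _ := by
    classical
    induction S using Finset.induction_on with
    | empty => simp only [Finset.sum_empty]; rfl
    | insert j S hj ih =>
      rw [Finset.sum_insert hj,
        ih (memLp_finsetSum S fun i _ => (he.memLp i r).const_mul (c i)),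
        ← MemLp.toLp_const_smul, ← MemLp.toLp_add]
      congr 1
      ext x
      simp [Finset.sum_insert hj]
  rw [h2]
  exact h1.coeFn_toLp

/-- On a probability space the `L¹` norm is the weakest, so `L¹` is where sums taken in different
`L^r` can be compared. -/
lemma tendsto_eLpNorm_one (he : UnimodularSystem μ e) {r : ℝ≥0∞} [Fact (1 ≤ r)] {c : ι → ℂ}
    {y : Lp ℂ r μ}
    (h : HasSum (fun i => c i • (he.memLp i r).toLp (e i)) y) :
    Filter.Tendsto (fun S : Finset ι => eLpNorm ((fun x => ∑ i ∈ S, c i * e i x) - ⇑y) 1 μ)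
      Filter.atTop (nhds 0) := by
  have h1 := tendsto_iff_edist_tendsto_0.1 h
  refine tendsto_of_tendsto_of_tendsto_of_le_of_le tendsto_const_nhds h1 (fun _ => zero_le)
    fun S => ?_
  simp only
  rw [Lp.edist_def]
  have h2 := he.coeFn_sum_toLp r c S
  have h3 : (fun x => ∑ i ∈ S, c i * e i x) - ⇑y =ᵐ[μ]
      ⇑(∑ i ∈ S, c i • (he.memLp i r).toLp (e i) : Lp ℂ r μ) - ⇑y := h2.symm.sub ae_eq_rfl
  rw [eLpNorm_congr_ae h3]
  exact eLpNorm_le_eLpNorm_of_exponent_le Fact.out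
    ((Lp.aestronglyMeasurable _).sub (Lp.aestronglyMeasurable _))

/-- Sums of the same series in `L^r` and `L^s` agree. -/
lemma ae_eq_of_hasSum (he : UnimodularSystem μ e) {r s : ℝ≥0∞} [Fact (1 ≤ r)] [Fact (1 ≤ s)]
    {c : ι → ℂ} {y : Lp ℂ r μ} {z : Lp ℂ s μ} (hy : HasSum (fun i => c i • (he.memLp i r).toLp (e i)) y)
    (hz : HasSum (fun i => c i • (he.memLp i s).toLp (e i)) z) : y =ᵐ[μ] z := by
  have hlim := (he.tendsto_eLpNorm_one hy).add (he.tendsto_eLpNorm_one hz)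
  rw [add_zero] at hlim
  have hle : eLpNorm (⇑y - ⇑z) 1 μ ≤ 0 := by
    refine ge_of_tendsto hlim (Filter.Eventually.of_forall fun S => ?_)
    have hm : AEStronglyMeasurable (fun x => ∑ i ∈ S, c i * e i x) μ :=
      Finset.aestronglyMeasurable_fun_sum _ fun i _ => (he.meas i).const_mul _
    have : ⇑y - ⇑z = ((fun x => ∑ i ∈ S, c i * e i x) - ⇑z)
        - ((fun x => ∑ i ∈ S, c i * e i x) - ⇑y) := by abel
    rw [this, add_comm]
    exact eLpNorm_sub_le (hm.sub (Lp.aestronglyMeasurable _))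
      (hm.sub (Lp.aestronglyMeasurable _)) le_rfl
  have h0 := (eLpNorm_eq_zero_iff ((Lp.aestronglyMeasurable y).sub (Lp.aestronglyMeasurable z))
    one_ne_zero).1 (le_antisymm hle zero_le)
  filter_upwards [h0] with x hx
  exact sub_eq_zero.1 hx

/-- The Fourier series of an element of the closed span of the system converges in `L²`. -/
lemma hasSum_coef (he : UnimodularSystem μ e) {f : X → ℂ} (hf : MemLp f 2 μ)
    (hcl : hf.toLp f ∈ (Submodule.span ℂ (Set.range he.toL2)).topologicalClosure) :
    HasSum (fun i => coef μ e f i • he.toL2 i) (hf.toLp f) := by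
  -- The system need not be total in `L²`, but it is a Hilbert basis of its closed span.
  set U := (Submodule.span ℂ (Set.range he.toL2)).topologicalClosure
  have : CompleteSpace U := (Submodule.isClosed_topologicalClosure _).completeSpace_coe
  have hmem : ∀ i, he.toL2 i ∈ U := fun i =>
    Submodule.le_topologicalClosure _ (Submodule.subset_span ⟨i, rfl⟩)
  set v : ι → U := fun i => ⟨he.toL2 i, hmem i⟩
  have hv : Orthonormal ℂ v := by
    refine ⟨fun i => he.orthonormal.1 i, fun i j hij => he.orthonormal.2 hij⟩
  have hd : (⊤ : Submodule ℂ U) ≤ (Submodule.span ℂ (Set.range v)).topologicalClosure := by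
    rintro ⟨x, hx⟩ -
    rw [← SetLike.mem_coe, Submodule.topologicalClosure_coe, Metric.mem_closure_iff]
    intro ε hε
    obtain ⟨y, hy, hxy⟩ := Metric.mem_closure_iff.1
      (show x ∈ closure (Submodule.span ℂ (Set.range he.toL2) : Set (Lp ℂ 2 μ)) from hx) ε hε
    have hyU : y ∈ U := Submodule.le_topologicalClosure _ hy
    refine ⟨⟨y, hyU⟩, ?_, hxy⟩
    have h1 : Submodule.map U.subtype (Submodule.span ℂ (Set.range v)) =
        Submodule.span ℂ (Set.range he.toL2) := by
      rw [Submodule.map_span, ← Set.range_comp]; rfl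
    rw [SetLike.mem_coe, ← h1] at hy
    obtain ⟨z, hz, hzy⟩ := hy
    have : z = ⟨y, hyU⟩ := Subtype.ext hzy
    exact this ▸ hz
  have hs := (HilbertBasis.mk hv hd).hasSum_repr ⟨hf.toLp f, hcl⟩
  have hs2 := hs.mapL U.subtypeL
  refine hs2.congr_fun fun i => ?_
  rw [HilbertBasis.repr_apply_apply, HilbertBasis.coe_mk, map_smul, ← he.inner_toL2 hf i]
  rfl

/-- The `i`-th summand of the multiplier with symbol `σ`, as a map from `L^p` to `L^q`. -/
def summand (he : UnimodularSystem μ e) (p q : ℝ≥0∞) [Fact (1 ≤ p)] (σ : ι → ℂ) (i : ι) :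
    Lp ℂ p μ →ₗ[ℂ] Lp ℂ q μ where
  toFun u := (σ i * coef μ e u i) • (he.memLp i q).toLp (e i)
  map_add' u v := by
    have hu : Integrable u μ := (Lp.memLp u).integrable Fact.out
    have hv : Integrable v μ := (Lp.memLp v).integrable Fact.out
    rw [coef_congr_ae (Lp.coeFn_add u v), he.coef_add hu hv, mul_add, add_smul]
  map_smul' c u := by
    rw [coef_congr_ae (Lp.coeFn_smul c u), coef_smul, RingHom.id_apply, smul_smul]
    congr 1; ring

lemma enorm_sum_summand (he : UnimodularSystem μ e) (p q : ℝ≥0∞) [Fact (1 ≤ p)] [Fact (1 ≤ q)]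
    (σ : ι → ℂ) (u : Lp ℂ p μ) (S : Finset ι) :
    ‖∑ i ∈ S, he.summand p q σ i u‖ₑ =
      eLpNorm (fun x => ∑ i ∈ S, σ i * coef μ e u i * e i x) q μ := by
  rw [Lp.enorm_def, ← eLpNorm_congr_ae (he.coeFn_sum_toLp q (fun i => σ i * coef μ e u i) S)]
  rfl

lemma eLpNorm_two_sum_sq (he : UnimodularSystem μ e) (c : ι → ℂ) (S : Finset ι) :
    eLpNorm (fun x => ∑ i ∈ S, c i * e i x) 2 μ ^ 2 = ∑ i ∈ S, ‖c i‖ₑ ^ 2 := by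
  rw [← eLpNorm_congr_ae (he.coeFn_sum_toLp 2 c S), ← Lp.enorm_def]
  have h := he.orthonormal.inner_sum c c S
  change inner ℂ (∑ i ∈ S, c i • (he.memLp i 2).toLp (e i) : Lp ℂ 2 μ) _ = _ at h
  have h2 : ‖(∑ i ∈ S, c i • (he.memLp i 2).toLp (e i) : Lp ℂ 2 μ)‖ ^ 2 = ∑ i ∈ S, ‖c i‖ ^ 2 := by
    have h3 := inner_self_eq_norm_sq_to_K (𝕜 := ℂ)
      (∑ i ∈ S, c i • (he.memLp i 2).toLp (e i) : Lp ℂ 2 μ)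
    have h4 := h3.symm.trans h
    simp only [Complex.conj_mul'] at h4
    apply Complex.ofReal_injective
    push_cast
    exact h4
  simp only [← ofReal_norm, ← ENNReal.ofReal_pow (norm_nonneg _)]
  rw [h2, ENNReal.ofReal_sum_of_nonneg fun i _ => by positivity]

end UnimodularSystem

end

/-! ### Fundamental domains and the characters of the dual lattice -/

variable {d : ℕ} {L : Submodule ℤ (EuclideanSpace ℝ (Fin d))} {Ω : Set (EuclideanSpace ℝ (Fin d))}

lemma IsFundamentalDomain.isAddFundamentalDomain (hΩ : IsFundamentalDomain L Ω) :
    IsAddFundamentalDomain L Ω volume := by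
  refine IsAddFundamentalDomain.mk' hΩ.measurable fun x => ?_
  obtain ⟨l, hl, hu⟩ := hΩ.existsUnique x
  refine ⟨l, by simpa [Submodule.vadd_def, add_comm] using hl, fun m hm => hu m ?_⟩
  simpa [Submodule.vadd_def, add_comm] using hm

lemma vaddInvariantMeasure_lattice (L : Submodule ℤ (EuclideanSpace ℝ (Fin d))) :
    VAddInvariantMeasure L (EuclideanSpace ℝ (Fin d)) volume :=
  ⟨fun c s _ => measure_preimage_add volume (c : EuclideanSpace ℝ (Fin d)) s⟩

section Volume
open scoped Pointwise
variable [DiscreteTopology L] [IsZLattice ℝ L]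

lemma IsFundamentalDomain.volume_ne_zero (hΩ : IsFundamentalDomain L Ω) : volume Ω ≠ 0 :=
  have := vaddInvariantMeasure_lattice L
  hΩ.isAddFundamentalDomain.measure_ne_zero (NeZero.ne volume)

lemma IsFundamentalDomain.volume_ne_top (hΩ : IsFundamentalDomain L Ω) : volume Ω ≠ ⊤ := by
  have := vaddInvariantMeasure_lattice L
  let b := Module.Free.chooseBasis ℤ L
  rw [hΩ.isAddFundamentalDomain.measure_eq (ZLattice.isAddFundamentalDomain b volume)]
  exact (ZSpan.fundamentalDomain_isBounded (b.ofZLatticeBasis ℝ)).measure_lt_top.ne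

lemma IsFundamentalDomain.isProbabilityMeasure (hΩ : IsFundamentalDomain L Ω) :
    IsProbabilityMeasure (normVol Ω) :=
  ⟨by simp [normVol, ENNReal.inv_mul_cancel hΩ.volume_ne_zero hΩ.volume_ne_top]⟩

/-- A translate of `Ω` is again a fundamental domain, and a periodic function has the same integral
over any two of them. -/
lemma IsFundamentalDomain.integral_normVol_translate (hΩ : IsFundamentalDomain L Ω)
    {f : EuclideanSpace ℝ (Fin d) → ℂ} (hf : ∀ x, ∀ l ∈ L, f (x + l) = f x)
    (y : EuclideanSpace ℝ (Fin d)) :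
    ∫ x, f (y + x) ∂(normVol Ω) = ∫ x, f x ∂(normVol Ω) := by
  have := vaddInvariantMeasure_lattice L
  have hD := hΩ.isAddFundamentalDomain
  have hy : IsAddFundamentalDomain L (y +ᵥ Ω) volume := hD.vadd_of_comm y
  simp only [normVol, integral_smul_measure]
  congr 1
  have h1 : ∫ x in y +ᵥ Ω, f x = ∫ x in Ω, f x := by
    refine hy.setIntegral_eq hD fun g x => ?_
    rw [Submodule.vadd_def, vadd_eq_add, add_comm]
    exact hf x g g.2
  rw [← h1]
  exact ((measurePreserving_vadd y volume).setIntegral_image_emb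
    (measurableEmbedding_const_vadd y) f Ω).symm

end Volume

/-- The character `x ↦ e^{2πi κ·x}`. -/
def character (κ : EuclideanSpace ℝ (Fin d)) (x : EuclideanSpace ℝ (Fin d)) : ℂ :=
  Complex.exp (2 * Real.pi * Complex.I * ((inner ℝ κ x : ℝ) : ℂ))

lemma continuous_character (κ : EuclideanSpace ℝ (Fin d)) : Continuous (character κ) := by
  unfold character
  fun_prop

lemma character_add_right (κ x y : EuclideanSpace ℝ (Fin d)) :
    character κ (x + y) = character κ x * character κ y := by
  simp only [character, ← Complex.exp_add, inner_add_right]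
  congr 1; push_cast; ring

lemma character_sub_left (κ η x : EuclideanSpace ℝ (Fin d)) :
    character (κ - η) x = character κ x * starRingEnd ℂ (character η x) := by
  simp only [character, ← Complex.exp_conj, ← Complex.exp_add, inner_sub_left]
  congr 1; simp [Complex.conj_ofNat]; ring

lemma norm_character (κ x : EuclideanSpace ℝ (Fin d)) : ‖character κ x‖ = 1 := by
  have : (2 * Real.pi * Complex.I * ((inner ℝ κ x : ℝ) : ℂ)) =
      ((2 * Real.pi * inner ℝ κ x : ℝ) : ℂ) * Complex.I := by push_cast; ring
  rw [character, this, Complex.norm_exp_ofReal_mul_I]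

lemma character_of_mem {κ l : EuclideanSpace ℝ (Fin d)} (hκ : κ ∈ dualLattice L) (hl : l ∈ L) :
    character κ l = 1 := by
  obtain ⟨n, hn⟩ := hκ l hl
  rw [character, hn, Complex.exp_eq_one_iff]
  exact ⟨n, by push_cast; ring⟩

lemma coef_character (f : EuclideanSpace ℝ (Fin d) → ℂ) (κ : dualLattice L) :
    coef (normVol Ω) (fun κ : dualLattice L => character (κ : EuclideanSpace ℝ (Fin d))) f κ =
      fourierCoefficient Ω f κ := by
  simp only [coef, fourierCoefficient, character, ← Complex.exp_conj]
  congr with x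
  congr 2
  simp [Complex.conj_ofNat]

/-- The point is chosen with `κ · y = 1/2`, where the character equals `-1`. -/
lemma character_ne_one {κ : EuclideanSpace ℝ (Fin d)} (hκ : κ ≠ 0) :
    character κ ((2 * ‖κ‖ ^ 2)⁻¹ • κ) ≠ 1 := by
  have h : (inner ℝ κ ((2 * ‖κ‖ ^ 2)⁻¹ • κ) : ℝ) = 1 / 2 := by
    rw [inner_smul_right, real_inner_self_eq_norm_sq]
    have : ‖κ‖ ≠ 0 := norm_ne_zero_iff.2 hκ
    field_simp
  rw [character, h]
  have : (2 * Real.pi * Complex.I * ((1 / 2 : ℝ) : ℂ)) = Real.pi * Complex.I := by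
    push_cast; ring
  rw [this, Complex.exp_pi_mul_I]
  norm_num

lemma unimodularSystem_character [DiscreteTopology L] [IsZLattice ℝ L]
    (hΩ : IsFundamentalDomain L Ω) :
    UnimodularSystem (normVol Ω)
      (fun κ : dualLattice L => character (κ : EuclideanSpace ℝ (Fin d))) := by
  have := hΩ.isProbabilityMeasure
  refine ⟨fun κ => (continuous_character _).aestronglyMeasurable, fun κ x => norm_character _ _,
    fun κ => ?_, fun κ η hne => ?_⟩
  · simp only [← character_sub_left, sub_self]
    simp [character]
  · simp only [← character_sub_left]
    set ξ : EuclideanSpace ℝ (Fin d) := κ - η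
    have hξ : ξ ≠ 0 := sub_ne_zero.2 fun h => hne (Subtype.ext h)
    set y := (2 * ‖ξ‖ ^ 2)⁻¹ • ξ
    have hper : ∀ x, ∀ l ∈ L, character ξ (x + l) = character ξ x := fun x l hl => by
      rw [character_add_right, character_sub_left κ η l, character_of_mem κ.2 hl,
        character_of_mem η.2 hl]
      simp
    have h := hΩ.integral_normVol_translate hper y
    simp only [character_add_right ξ y] at h
    rw [integral_const_mul] at h
    -- Translation by `y` multiplies the integral by `character ξ y ≠ 1` yet preserves it, so it
    -- vanishes.
    have h2 : (character ξ y - 1) * ∫ x, character ξ x ∂(normVol Ω) = 0 := by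
      rw [sub_mul, h]; simp
    exact (mul_eq_zero.1 h2).resolve_left (sub_ne_zero.2 (character_ne_one hξ))

/-! ### Density of the characters, by passage to the standard torus -/

section Density
variable {ι : Type*} [Fintype ι]

/-- The projection to the torus in the coordinates of a basis. -/
def torusMap (B : Module.Basis ι ℝ (EuclideanSpace ℝ (Fin d))) (x : EuclideanSpace ℝ (Fin d)) :
    UnitAddTorus ι := fun i => ((B.equivFun x i : ℝ) : UnitAddCircle)

lemma isQuotientMap_torusMap (B : Module.Basis ι ℝ (EuclideanSpace ℝ (Fin d))) :
    Topology.IsQuotientMap (torusMap B) := by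
  have h1 : IsOpenQuotientMap
      (Pi.map fun _ : ι => ((↑) : ℝ → UnitAddCircle)) :=
    IsOpenQuotientMap.piMap fun _ => QuotientAddGroup.isOpenQuotientMap_mk
  exact h1.isQuotientMap.comp B.equivFunL.toHomeomorph.isQuotientMap

variable [DiscreteTopology L] [IsZLattice ℝ L]

lemma sub_mem_of_torusMap_eq (b : Module.Basis ι ℤ L) {x y : EuclideanSpace ℝ (Fin d)}
    (h : torusMap (b.ofZLatticeBasis ℝ) x = torusMap (b.ofZLatticeBasis ℝ) y) : x - y ∈ L := by
  set B := b.ofZLatticeBasis ℝ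
  have h1 : ∀ i, ∃ n : ℤ, B.equivFun (x - y) i = n := fun i => by
    have h2 := congrFun h i
    simp only [torusMap] at h2
    rw [QuotientAddGroup.eq, AddSubgroup.mem_zmultiples_iff] at h2
    obtain ⟨n, hn⟩ := h2
    refine ⟨-n, ?_⟩
    simp only [zsmul_eq_mul, mul_one] at hn
    rw [map_sub, Pi.sub_apply]
    push_cast
    linarith
  choose n hn using h1
  rw [← B.sum_equivFun (x - y)]
  refine L.sum_mem fun i _ => ?_
  rw [hn i, Int.cast_smul_eq_zsmul]
  refine L.smul_mem _ ?_
  simp [B]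

/-- Points with the same torus image differ by a lattice vector, so `f` descends through the
quotient map. Compactness of the torus and Stone–Weierstrass then become available. -/
lemma exists_continuousMap_torus (b : Module.Basis ι ℤ L) {f : EuclideanSpace ℝ (Fin d) → ℂ}
    (hf : Continuous f) (hper : ∀ x, ∀ l ∈ L, f (x + l) = f x) :
    ∃ G : C(UnitAddTorus ι, ℂ), ∀ x, G (torusMap (b.ofZLatticeBasis ℝ) x) = f x := by
  have hq := isQuotientMap_torusMap (b.ofZLatticeBasis ℝ)
  have hfac : Function.FactorsThrough f (torusMap (b.ofZLatticeBasis ℝ)) := fun x y hxy => by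
    have := hper y _ (sub_mem_of_torusMap_eq b hxy)
    rwa [add_sub_cancel] at this
  obtain ⟨s, hs⟩ := hq.surjective.hasRightInverse
  have hG : ∀ x, f (s (torusMap (b.ofZLatticeBasis ℝ) x)) = f x := fun x => hfac (hs _)
  refine ⟨⟨f ∘ s, hq.continuous_iff.2 ?_⟩, hG⟩
  convert hf using 1
  exact funext hG

/-- Every torus monomial is a character from the dual lattice. -/
lemma exists_dual_character (b : Module.Basis ι ℤ L) (n : ι → ℤ) :
    ∃ κ : dualLattice L, ∀ x, UnitAddTorus.mFourier n (torusMap (b.ofZLatticeBasis ℝ) x) =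
      character (κ : EuclideanSpace ℝ (Fin d)) x := by
  set B := b.ofZLatticeBasis ℝ
  -- The frequency `n` gives an integral functional on `L`; its Riesz representative is the dual
  -- vector.
  let ℓ : EuclideanSpace ℝ (Fin d) →ₗ[ℝ] ℝ := ∑ i, (n i : ℝ) • B.coord i
  let κ := (InnerProductSpace.toDual ℝ (EuclideanSpace ℝ (Fin d))).symm
    (LinearMap.toContinuousLinearMap ℓ)
  have hκ : ∀ x, inner ℝ κ x = ∑ i, (n i : ℝ) * B.repr x i := fun x => by
    rw [InnerProductSpace.toDual_symm_apply]
    simp [ℓ]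
  refine ⟨⟨κ, fun l hl => ⟨∑ i, n i * b.repr ⟨l, hl⟩ i, ?_⟩⟩, fun x => ?_⟩
  · rw [hκ]
    push_cast
    refine Finset.sum_congr rfl fun i _ => ?_
    have := b.ofZLatticeBasis_repr_apply ℝ L ⟨l, hl⟩ i
    simp only at this
    rw [this]
  · simp only [UnitAddTorus.mFourier, ContinuousMap.coe_mk, torusMap, fourier_coe_apply, character]
    rw [← Complex.exp_sum, hκ]
    congr 1
    push_cast
    rw [Finset.mul_sum]
    refine Finset.sum_congr rfl fun i _ => ?_
    simp only [Module.Basis.equivFun_apply]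
    ring

lemma memLp_of_continuous_periodic (hΩ : IsFundamentalDomain L Ω)
    {f : EuclideanSpace ℝ (Fin d) → ℂ} (hf : Continuous f)
    (hper : ∀ x, ∀ l ∈ L, f (x + l) = f x) (r : ℝ≥0∞) : MemLp f r (normVol Ω) := by
  have := hΩ.isProbabilityMeasure
  obtain ⟨G, hG⟩ := exists_continuousMap_torus (Module.Free.chooseBasis ℤ L) hf hper
  refine MemLp.of_bound hf.aestronglyMeasurable ‖G‖ (Filter.Eventually.of_forall fun x => ?_)
  rw [← hG]
  exact G.norm_coe_le_norm _

/-- Continuous periodic functions lie in the closed span of the characters. -/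
lemma toLp_mem_closure_span [IsProbabilityMeasure (normVol Ω)]
    (he : UnimodularSystem (normVol Ω)
      (fun κ : dualLattice L => character (κ : EuclideanSpace ℝ (Fin d))))
    {f : EuclideanSpace ℝ (Fin d) → ℂ} (hf : Continuous f)
    (hper : ∀ x, ∀ l ∈ L, f (x + l) = f x) (hL : MemLp f 2 (normVol Ω)) :
    hL.toLp f ∈ (Submodule.span ℂ (Set.range he.toL2)).topologicalClosure := by
  let b := Module.Free.chooseBasis ℤ L
  set τ := torusMap (b.ofZLatticeBasis ℝ)
  have hτ : Continuous τ := (isQuotientMap_torusMap _).continuous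
  have hmem : ∀ G : C(UnitAddTorus _, ℂ), MemLp (fun x => G (τ x)) 2 (normVol Ω) := fun G =>
    MemLp.of_bound (G.continuous.comp hτ).aestronglyMeasurable ‖G‖
      (Filter.Eventually.of_forall fun x => G.norm_coe_le_norm _)
  let Λ₀ : C(UnitAddTorus _, ℂ) →ₗ[ℂ] Lp ℂ 2 (normVol Ω) :=
    { toFun := fun G => (hmem G).toLp _
      map_add' := fun G H => MemLp.toLp_add (hmem G) (hmem H)
      map_smul' := fun c G => MemLp.toLp_const_smul c (hmem G) }
  -- Pullback is continuous from the sup norm to `L²`, so uniform approximation by monomials becomes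
  -- `L²` approximation by characters.
  let Λ := Λ₀.mkContinuous 1 fun G => by
    have h1 : ∀ᵐ x ∂(normVol Ω), ‖Λ₀ G x‖ ≤ ‖G‖ := by
      filter_upwards [(hmem G).coeFn_toLp] with x hx
      change ‖(hmem G).toLp _ x‖ ≤ _
      rw [hx]
      exact G.norm_coe_le_norm _
    have h2 := Lp.norm_le_of_ae_bound (norm_nonneg G) h1
    have h3 : measureUnivNNReal (normVol Ω) = 1 := by simp [measureUnivNNReal]
    simpa [h3] using h2
  obtain ⟨G, hG⟩ := exists_continuousMap_torus b hf hper
  have hΛG : Λ G = hL.toLp f := by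
    change (hmem G).toLp _ = _
    congr 1
    exact funext hG
  have hG' : G ∈ closure (Submodule.span ℂ (Set.range
      (UnitAddTorus.mFourier (d := Module.Free.ChooseBasisIndex ℤ L))) :
        Set C(UnitAddTorus (Module.Free.ChooseBasisIndex ℤ L), ℂ)) := by
    rw [← Submodule.topologicalClosure_coe, UnitAddTorus.span_mFourier_closure_eq_top]
    trivial
  rw [← hΛG]
  refine map_mem_closure Λ.continuous hG' fun P hP => ?_
  have hmap : Submodule.span ℂ (Set.range
      (UnitAddTorus.mFourier (d := Module.Free.ChooseBasisIndex ℤ L))) ≤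
      (Submodule.span ℂ (Set.range he.toL2)).comap Λ.toLinearMap := by
    rw [Submodule.span_le]
    rintro _ ⟨n, rfl⟩
    obtain ⟨κ, hκ⟩ := exists_dual_character b n
    have : Λ (UnitAddTorus.mFourier n) = he.toL2 κ := by
      change (hmem _).toLp _ = (he.memLp κ 2).toLp _
      congr 1
      exact funext hκ
    change Λ (UnitAddTorus.mFourier n) ∈ Submodule.span ℂ (Set.range he.toL2)
    rw [this]
    exact Submodule.subset_span ⟨κ, rfl⟩
  exact hmap hP

end Density

/-! ### The two multiplier bounds and the extension -/

lemma sqrt_sum_norm_sq_eq {ι : Type*} (c : ι → ℂ) (S : Finset ι) :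
    ENNReal.ofReal √(∑ i ∈ S, ‖c i‖ ^ 2) = (∑ i ∈ S, ‖c i‖ₑ ^ 2) ^ (2⁻¹ : ℝ) := by
  have h : 0 ≤ ∑ i ∈ S, ‖c i‖ ^ 2 := Finset.sum_nonneg fun i _ => sq_nonneg _
  rw [Real.sqrt_eq_rpow, ← ENNReal.ofReal_rpow_of_nonneg h (by norm_num),
    ENNReal.ofReal_sum_of_nonneg fun i _ => by positivity]
  simp only [ENNReal.ofReal_pow (norm_nonneg _), ofReal_norm, one_div]

lemma sum_norm_sq_le_of_tsum_enorm_sq_le {ι : Type*} {c : ι → ℂ} {R : ℝ} (hR : 0 ≤ R)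
    (h : ∑' i, ‖c i‖ₑ ^ 2 ≤ ENNReal.ofReal R ^ 2) (S : Finset ι) :
    ∑ i ∈ S, ‖c i‖ ^ 2 ≤ R ^ 2 := by
  have h1 := (ENNReal.sum_le_tsum S).trans h
  simp only [← ofReal_norm, ← ENNReal.ofReal_pow (norm_nonneg _)] at h1
  rw [← ENNReal.ofReal_sum_of_nonneg fun i _ => by positivity, ← ENNReal.ofReal_pow hR] at h1
  exact (ENNReal.ofReal_le_ofReal_iff (by positivity)).1 h1

lemma enorm_Lp_eq_ofReal {X : Type*} [MeasurableSpace X] {μ : Measure X} {r : ℝ≥0∞}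
    (u : Lp ℂ r μ) : eLpNorm u r μ = ENNReal.ofReal ‖u‖ := by
  rw [Lp.norm_def, ENNReal.ofReal_toReal (Lp.memLp u).2.ne]

/-- The multiplier series converges from `L^p` to `L^q` for `p, q ≤ 2`. -/
theorem exists_multiplier_of_le_two {p q : ℝ} (hp : 1 < p) (hp2 : p ≤ 2) (hq2 : q ≤ 2)
    [Fact (1 ≤ ENNReal.ofReal p)] [Fact (1 ≤ ENNReal.ofReal q)] :
    ∃ C : ℝ≥0, ∀ {X : Type*} [MeasurableSpace X] {ι : Type*} {μ : Measure X}
      [IsProbabilityMeasure μ] {e : ι → X → ℂ} (he : UnimodularSystem μ e)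
      {σ : ι → ℂ}, weakSup σ (1 / p - 1 / 2) < ⊤ →
      ∃ T : Lp ℂ (ENNReal.ofReal p) μ →ₗ[ℂ] Lp ℂ (ENNReal.ofReal q) μ,
        (∀ u, HasSum (fun i => he.summand _ _ σ i u) (T u)) ∧
        ∀ u, ‖T u‖ ≤ C * (weakSup σ (1 / p - 1 / 2)).toReal * ‖u‖ := by
  obtain ⟨C, hC⟩ := exists_tsum_le hp hp2
  refine ⟨C, fun {X _ ι μ _ e} he {σ} hσ => ?_⟩
  set M := weakSup σ (1 / p - 1 / 2)
  have hKu : ∀ u : Lp ℂ (ENNReal.ofReal p) μ,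
      C * M * eLpNorm u (ENNReal.ofReal p) μ = ENNReal.ofReal (C * M.toReal * ‖u‖) := fun u => by
    rw [enorm_Lp_eq_ofReal, ENNReal.ofReal_mul (by positivity), ENNReal.ofReal_mul (by positivity),
      ENNReal.ofReal_toReal hσ.ne, ENNReal.ofReal_coe_nnreal]
  -- Here `σ` stays with the coefficients: analysis costs `C * M`, and synthesis costs 1 because `q
  -- ≤ 2`.
  obtain ⟨T, hT, hTb⟩ := exists_linearMap_hasSum
    (V := Lp ℂ (ENNReal.ofReal p) μ) (W := Lp ℂ (ENNReal.ofReal q) μ)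
    (fun i => he.summand _ _ σ i) (fun i u => ‖σ i * coef μ e u i‖) (D := 1) (K := C * M.toReal)
    zero_le_one (by positivity)
    (fun u S => by
      refine sum_norm_sq_le_of_tsum_enorm_sq_le (by positivity) ?_ S
      have := hC he hσ (Lp.memLp u)
      change _ ≤ (C * M * _) ^ 2 at this
      rw [hKu] at this
      simpa only [enorm_mul] using this)
    (fun u S => by
      rw [one_mul, ← ENNReal.ofReal_le_ofReal_iff (Real.sqrt_nonneg _), sqrt_sum_norm_sq_eq,
        ofReal_norm, he.enorm_sum_summand, ← he.eLpNorm_two_sum_sq, ← ENNReal.rpow_natCast,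
        ← ENNReal.rpow_mul]
      norm_num
      refine eLpNorm_le_eLpNorm_of_exponent_le (by simpa using hq2) ?_
      exact Finset.aestronglyMeasurable_fun_sum _ fun i _ => (he.meas i).const_mul _)
  exact ⟨T, hT, fun u => by simpa using hTb u⟩

/-- The multiplier series converges from `L^p` to `L^q` for `p, q ≥ 2`. -/
theorem exists_multiplier_of_two_le {p q : ℝ} (hp2 : 2 ≤ p) (hq2 : 2 ≤ q)
    [Fact (1 ≤ ENNReal.ofReal p)] [Fact (1 ≤ ENNReal.ofReal q)] :
    ∃ C : ℝ≥0, ∀ {X : Type*} [MeasurableSpace X] {ι : Type*} {μ : Measure X}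
      [IsProbabilityMeasure μ] {e : ι → X → ℂ} (he : UnimodularSystem μ e)
      {σ : ι → ℂ}, weakSup σ (1 / q.conjExponent - 1 / 2) < ⊤ →
      ∃ T : Lp ℂ (ENNReal.ofReal p) μ →ₗ[ℂ] Lp ℂ (ENNReal.ofReal q) μ,
        (∀ u, HasSum (fun i => he.summand _ _ σ i u) (T u)) ∧
        ∀ u, ‖T u‖ ≤ C * (weakSup σ (1 / q.conjExponent - 1 / 2)).toReal * ‖u‖ := by
  obtain ⟨C, hC⟩ := exists_eLpNorm_sum_le hq2
  refine ⟨C, fun {X _ ι μ _ e} he {σ} hσ => ?_⟩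
  set M := weakSup σ (1 / q.conjExponent - 1 / 2)
  have h2p : (2 : ℝ≥0∞) ≤ ENNReal.ofReal p := by simpa using ENNReal.ofReal_le_ofReal hp2
  -- Here the roles are exchanged: analysis costs 1 by Bessel and `p ≥ 2`, and synthesis with `σ`
  -- costs `C * M`.
  obtain ⟨T, hT, hTb⟩ := exists_linearMap_hasSum
    (V := Lp ℂ (ENNReal.ofReal p) μ) (W := Lp ℂ (ENNReal.ofReal q) μ)
    (fun i => he.summand _ _ σ i) (fun i u => ‖coef μ e u i‖) (D := C * M.toReal) (K := 1)
    (by positivity) zero_le_one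
    (fun u S => by
      refine sum_norm_sq_le_of_tsum_enorm_sq_le (by positivity) ?_ S
      refine (he.tsum_enorm_coef_sq_le ((Lp.memLp u).mono_exponent h2p)).trans ?_
      rw [← eLpNorm_two_sq, one_mul, ← enorm_Lp_eq_ofReal]
      gcongr
      exact eLpNorm_le_eLpNorm_of_exponent_le h2p (Lp.aestronglyMeasurable u))
    (fun u S => by
      rw [← ENNReal.ofReal_le_ofReal_iff (by positivity), ENNReal.ofReal_mul (by positivity),
        sqrt_sum_norm_sq_eq, ENNReal.ofReal_mul (by positivity), ENNReal.ofReal_toReal hσ.ne,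
        ENNReal.ofReal_coe_nnreal, ofReal_norm, he.enorm_sum_summand]
      exact hC he hσ _ S)
  exact ⟨T, hT, fun u => by simpa using hTb u⟩

/-- A bounded sum of the multiplier series extends the multiplier. -/
lemma opNorm_le_and_hasBoundedExtension {p q : ℝ}
    [Fact (1 ≤ ENNReal.ofReal p)] [Fact (1 ≤ ENNReal.ofReal q)] {d : ℕ}
    {L : Submodule ℤ (EuclideanSpace ℝ (Fin d))} [DiscreteTopology L] [IsZLattice ℝ L]
    {Ω : Set (EuclideanSpace ℝ (Fin d))} (hΩ : IsFundamentalDomain L Ω)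
    {A : smoothPeriodic L → smoothPeriodic L} {σ : dualLattice L → ℂ}
    (hA : IsFourierMultiplier Ω A σ) [IsProbabilityMeasure (normVol Ω)]
    (he : UnimodularSystem (normVol Ω)
      (fun κ : dualLattice L => character (κ : EuclideanSpace ℝ (Fin d))))
    (T : Lp ℂ (ENNReal.ofReal p) (normVol Ω) →ₗ[ℂ] Lp ℂ (ENNReal.ofReal q) (normVol Ω))
    (hT : ∀ u, HasSum (fun i => he.summand _ _ σ i u) (T u)) {C : ℝ≥0} {M : ℝ≥0∞} (hM : M < ⊤)
    (hTb : ∀ u, ‖T u‖ ≤ C * M.toReal * ‖u‖) :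
    opNorm Ω p q A ≤ C * M ∧ HasBoundedExtension Ω p q A := by
  have hext : ∀ f : smoothPeriodic L, ∃ u : Lp ℂ (ENNReal.ofReal p) (normVol Ω),
      u =ᵐ[normVol Ω] (f : EuclideanSpace ℝ (Fin d) → ℂ) ∧
      T u =ᵐ[normVol Ω] (A f : EuclideanSpace ℝ (Fin d) → ℂ) := fun f => by
    have hfL := memLp_of_continuous_periodic hΩ f.2.1.continuous f.2.2 (ENNReal.ofReal p)
    have hAL := memLp_of_continuous_periodic hΩ (A f).2.1.continuous (A f).2.2 2
    refine ⟨hfL.toLp _, hfL.coeFn_toLp, ?_⟩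
    have h2 := he.hasSum_coef hAL
      (toLp_mem_closure_span he (A f).2.1.continuous (A f).2.2 hAL)
    -- One series, summed to `T u` in `L^q` and to `A f` in `L²`: the multiplier identity makes the
    -- terms equal.
    refine (he.ae_eq_of_hasSum (hT (hfL.toLp _)) (h2.congr_fun fun κ => ?_)).trans hAL.coeFn_toLp
    rw [coef_congr_ae hfL.coeFn_toLp, coef_character, coef_character, hA f κ]
    rfl
  refine ⟨iSup₂_le fun f _ => ?_, T, ⟨_, hTb⟩, hext⟩
  obtain ⟨u, hu, hTu⟩ := hext f
  refine ENNReal.div_le_of_le_mul ?_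
  rw [← eLpNorm_congr_ae hu, ← eLpNorm_congr_ae hTu, enorm_Lp_eq_ofReal, enorm_Lp_eq_ofReal]
  refine (ENNReal.ofReal_le_ofReal (hTb u)).trans_eq ?_
  rw [ENNReal.ofReal_mul (by positivity), ENNReal.ofReal_mul (by positivity),
    ENNReal.ofReal_toReal hM.ne, ENNReal.ofReal_coe_nnreal]

end LatticeFourier

end

theorem mainTheorem2 (p q : ℝ) (hp : 1 < p) (hq : 1 < q) :
    (p ≤ 2 → q ≤ 2 → ∃ C : ℝ≥0, ∀ (d : ℕ) (L : Submodule ℤ (EuclideanSpace ℝ (Fin d)))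
      [DiscreteTopology L] [IsZLattice ℝ L] (Ω : Set (EuclideanSpace ℝ (Fin d)))
      (_ : LatticeFourier.IsFundamentalDomain L Ω)
      (A : LatticeFourier.smoothPeriodic L → LatticeFourier.smoothPeriodic L)
      (σ : LatticeFourier.dualLattice L → ℂ) (_ : LatticeFourier.IsFourierMultiplier Ω A σ)
      (_ : LatticeFourier.weakNorm σ (1 / p - 1 / 2) < ⊤),
      LatticeFourier.opNorm Ω p q A ≤ C * LatticeFourier.weakNorm σ (1 / p - 1 / 2) ∧
      LatticeFourier.HasBoundedExtension Ω p q A) ∧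
    (2 ≤ p → 2 ≤ q → ∃ C : ℝ≥0, ∀ (d : ℕ) (L : Submodule ℤ (EuclideanSpace ℝ (Fin d)))
      [DiscreteTopology L] [IsZLattice ℝ L] (Ω : Set (EuclideanSpace ℝ (Fin d)))
      (_ : LatticeFourier.IsFundamentalDomain L Ω)
      (A : LatticeFourier.smoothPeriodic L → LatticeFourier.smoothPeriodic L)
      (σ : LatticeFourier.dualLattice L → ℂ) (_ : LatticeFourier.IsFourierMultiplier Ω A σ)
      (_ : LatticeFourier.weakNorm σ (1 / q.conjExponent - 1 / 2) < ⊤),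
      LatticeFourier.opNorm Ω p q A ≤
        C * LatticeFourier.weakNorm σ (1 / q.conjExponent - 1 / 2) ∧
      LatticeFourier.HasBoundedExtension Ω p q A) := by
  have : Fact (1 ≤ ENNReal.ofReal p) := ⟨by simpa using hp.le⟩
  have : Fact (1 ≤ ENNReal.ofReal q) := ⟨by simpa using hq.le⟩
  constructor
  · intro hp2 hq2
    obtain ⟨C, hC⟩ := LatticeFourier.exists_multiplier_of_le_two (q := q) hp hp2 hq2
    refine ⟨C, fun d L _ _ Ω hΩ A σ hA hσ => ?_⟩
    have := hΩ.isProbabilityMeasure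
    have he := LatticeFourier.unimodularSystem_character hΩ
    -- `weakNorm` and `weakSup` have the same body, so `hσ` fits by unfolding.
    obtain ⟨T, hT, hTb⟩ := hC he hσ
    exact LatticeFourier.opNorm_le_and_hasBoundedExtension hΩ hA he T hT hσ hTb
  · intro hp2 hq2
    obtain ⟨C, hC⟩ := LatticeFourier.exists_multiplier_of_two_le hp2 hq2
    refine ⟨C, fun d L _ _ Ω hΩ A σ hA hσ => ?_⟩
    have := hΩ.isProbabilityMeasure
    have he := LatticeFourier.unimodularSystem_character hΩ
    obtain ⟨T, hT, hTb⟩ := hC he hσ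
    exact LatticeFourier.opNorm_le_and_hasBoundedExtension hΩ hA he T hT hσ hTb
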